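/- Let $R$ be a Cohen–Macaulay (Noetherian) local ring which admits a canonical module, that is, a maximal Cohen–Macaulay module of type $1$ and of finite injective dimension. For a finite sequence $f=f_1,\dots,f_n$ in $R$ let $H_i(f,R)$ denote the $i$-th homology of the Koszul complex of $f$ over $R$. Let $I$ be a strongly Cohen–Macaulay ideal of $R$, i.e. $I$ has a generating set $g$ such that every $H_i(g,R)$ is a Cohen–Macaulay $R$-module (the zero module being regarded as Cohen–Macaulay). Let $J=(\underline{x})$, where $\underline{x}$ is a maximal $R$-regular sequence in $I$, i.e. an $R$-regular sequence of elements of $I$ that cannot be extended by an element of $I$ to a longer one. Let $f=f_1,\dots,f_n$ be a generating set of $I$ which is minimal ($n=\mu_R(I)$), or an arbitrary finite generating set of $I$ if $J\neq I$, and write $H_i(I,R)=H_i(f,R)$; it is annihilated by $I$, hence is an $R/J$-module. Then $$\delta_{R/J}(H_i(I,R))=0\qquad\text{for all } i>0.$$ Here, for a finitely generated module $M$ over a local ring $A$, $\delta_A(M)=\mu_A(M/M^{\mathrm{cm}})$, where $\mu_A$ is the minimal number of generators and $M^{\mathrm{cm}}$ is the sum of the submodules $\varphi(L)\subseteq M$,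 with $L$ ranging over all maximal Cohen–Macaulay $A$-modules without non-zero free direct summands and $\varphi$ over all $A$-linear maps $L\to M$. -/

import Mathlib

universe u v

open Finset in
/-- The differential of the Koszul complex `K(f; M)` of `f = (f₀, …, f₍ₙ₋₁₎)` with coefficients in
`M`. An element of the complex is written as `∑ₛ φ(s) e_s`, where `e_s = e_{i₁} ∧ ⋯ ∧ e_{iₚ}` for
`s = {i₁ < ⋯ < iₚ}`, and `d (e_s) = ∑ᵣ (-1)^(r-1) f_{iᵣ} e_{s ∖ {iᵣ}}`. Hence the coefficient of
`e_t` in `d φ` is `∑_{j ∉ t} (-1)^#{k ∈ t | k < j} f_j φ(t ∪ {j})`. -/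
def koszulDifferential {R : Type u} [CommRing R] (M : Type v) [AddCommGroup M] [Module R M]
    {n : ℕ} (f : Fin n → R) : (Finset (Fin n) → M) →ₗ[R] (Finset (Fin n) → M) where
  toFun φ t := ∑ j ∈ tᶜ, ((-1 : R) ^ #{k ∈ t | k < j} * f j) • φ (insert j t)
  map_add' φ ψ := by
    ext t
    simp [Finset.sum_add_distrib]
  map_smul' r φ := by
    ext t
    simp only [Pi.smul_apply, RingHom.id_apply, Finset.smul_sum]
    exact Finset.sum_congr rfl fun j _ => smul_comm _ _ _

/-- The degree `i` part `K_i(f; M)` of the Koszul complex: combinations of the `e_s`, `#s = i`. -/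
def koszulChains (R : Type u) [CommRing R] (M : Type v) [AddCommGroup M] [Module R M]
    (n i : ℕ) : Submodule R (Finset (Fin n) → M) where
  carrier := {φ | ∀ s : Finset (Fin n), s.card ≠ i → φ s = 0}
  add_mem' hφ hψ s hs := by simp [hφ s hs, hψ s hs]
  zero_mem' _ _ := rfl
  smul_mem' r φ hφ s hs := by simp [hφ s hs]

/-- The `i`-cycles of the Koszul complex (note that `d` vanishes on degree `0`). -/
def koszulCycles {R : Type u} [CommRing R] (M : Type v) [AddCommGroup M] [Module R M]
    {n : ℕ} (f : Fin n → R) (i : ℕ) : Submodule R (Finset (Fin n) → M) :=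
  koszulChains R M n i ⊓ LinearMap.ker (koszulDifferential M f)

/-- The `i`-boundaries of the Koszul complex. -/
def koszulBoundaries {R : Type u} [CommRing R] (M : Type v) [AddCommGroup M] [Module R M]
    {n : ℕ} (f : Fin n → R) (i : ℕ) : Submodule R (Finset (Fin n) → M) :=
  (koszulChains R M n (i + 1)).map (koszulDifferential M f)

/-- The Koszul homology `H_i(f; M)`: cycles modulo boundaries. -/
abbrev koszulHomology {R : Type u} [CommRing R] (M : Type v) [AddCommGroup M] [Module R M]
    {n : ℕ} (f : Fin n → R) (i : ℕ) : Type v :=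
  koszulCycles M f i ⧸ (koszulBoundaries M f i).submoduleOf (koszulCycles M f i)

open Finset in
theorem koszulSign_insert {R : Type u} [CommRing R] {n : ℕ} (t : Finset (Fin n)) (j k : Fin n)
    (hk : k ∉ t) :
    (-1 : R) ^ #{l ∈ insert k t | l < j} =
      (if k < j then -1 else 1) * (-1 : R) ^ #{l ∈ t | l < j} := by
  rw [Finset.filter_insert]
  split_ifs with h
  · rw [Finset.card_insert_of_notMem (by simp [hk]), pow_succ, mul_comm]
  · rw [one_mul]

theorem koszulDifferential_sq {R : Type u} [CommRing R] {M : Type v} [AddCommGroup M] [Module R M]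
    {n : ℕ} (f : Fin n → R) (φ : Finset (Fin n) → M) :
    koszulDifferential M f (koszulDifferential M f φ) = 0 := by
  ext t
  simp only [koszulDifferential, LinearMap.coe_mk, AddHom.coe_mk, Pi.zero_apply, Finset.smul_sum,
    Finset.sum_sigma']
  refine Finset.sum_involution (fun x _ => ⟨x.2, x.1⟩) ?_ ?_ ?_ ?_
  · rintro ⟨j, k⟩ h
    simp only [Finset.mem_sigma, Finset.mem_compl, Finset.mem_insert, not_or] at h
    obtain ⟨hj, hkj, hk⟩ := h
    simp only
    rw [koszulSign_insert t k j hj, koszulSign_insert t j k hk, Finset.insert_comm k j t, smul_smul,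
      smul_smul, ← add_smul]
    rcases lt_or_gt_of_ne hkj with h | h
    · rw [if_neg (not_lt.2 h.le), if_pos h]
      convert zero_smul R _
      ring
    · rw [if_pos h, if_neg (not_lt.2 h.le)]
      convert zero_smul R _
      ring
  · rintro ⟨j, k⟩ h _ e
    simp only [Finset.mem_sigma, Finset.mem_compl, Finset.mem_insert, not_or] at h
    simp only [Sigma.mk.injEq] at e
    exact h.2.1 e.1
  · rintro ⟨j, k⟩ h
    simp only [Finset.mem_sigma, Finset.mem_compl, Finset.mem_insert, not_or] at h ⊢
    exact ⟨h.2.2, fun e => h.2.1 e.symm, h.1⟩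
  · rintro ⟨j, k⟩ _
    rfl

theorem koszulBoundaries_le_koszulCycles {R : Type u} [CommRing R] (M : Type v) [AddCommGroup M]
    [Module R M] {n : ℕ} (f : Fin n → R) (i : ℕ) :
    koszulBoundaries M f i ≤ koszulCycles M f i := by
  rintro _ ⟨φ, hφ, rfl⟩
  refine ⟨fun s hs => ?_, koszulDifferential_sq f φ⟩
  refine Finset.sum_eq_zero fun j hj => ?_
  rw [hφ (insert j s), smul_zero]
  rw [Finset.card_insert_of_notMem (by simpa using hj)]
  omega

open Finset in
/-- Multiplication by `f j` maps cycles to boundaries. -/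
theorem koszul_smul_mem_boundaries {R : Type u} [CommRing R] {M : Type v} [AddCommGroup M]
    [Module R M] {n : ℕ} (f : Fin n → R) (i : ℕ) (j : Fin n) {φ : Finset (Fin n) → M}
    (hφ : φ ∈ koszulCycles M f i) : f j • φ ∈ koszulBoundaries M f i := by
  refine ⟨fun s => if j ∈ s then ((-1 : R) ^ #{l ∈ s | l < j}) • φ (s.erase j) else 0, ?_, ?_⟩
  · intro s hs
    dsimp only
    split_ifs with h
    · rw [hφ.1 _, smul_zero]
      rw [Finset.card_erase_of_mem h]
      have := Finset.card_pos.2 ⟨j, h⟩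
      omega
    · rfl
  · have hs : ∀ m : ℕ, (-1 : R) ^ m * (-1 : R) ^ m = 1 := fun m => by
      rw [← mul_pow]; simp
    ext t
    simp only [koszulDifferential, LinearMap.coe_mk, AddHom.coe_mk, Pi.smul_apply]
    by_cases hj : j ∈ t
    · have hz : koszulDifferential M f φ (t.erase j) = 0 := by
        rw [LinearMap.mem_ker.1 hφ.2]; rfl
      simp only [koszulDifferential, LinearMap.coe_mk, AddHom.coe_mk] at hz
      have hc : (t.erase j)ᶜ = insert j tᶜ := by
        ext x; simp only [Finset.mem_compl, Finset.mem_erase, Finset.mem_insert]; tauto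
      rw [hc, Finset.sum_insert (by simpa using hj), Finset.insert_erase hj] at hz
      have key : ∀ k ∈ tᶜ, ((-1 : R) ^ #{l ∈ t | l < k} * f k) •
          (if j ∈ insert k t then
            ((-1 : R) ^ #{l ∈ insert k t | l < j}) • φ ((insert k t).erase j) else 0) =
          -((-1 : R) ^ #{l ∈ t.erase j | l < j} • (((-1 : R) ^ #{l ∈ t.erase j | l < k} * f k) •
            φ (insert k (t.erase j)))) := by
        intro k hk
        have hk' : k ∉ t := by simpa using hk
        have hkj : k ≠ j := fun e => hk' (e ▸ hj)
        have h1 := koszulSign_insert (R := R) (t.erase j) k j (by simp)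
        have h2 := koszulSign_insert (R := R) (t.erase j) j j (by simp)
        rw [Finset.insert_erase hj] at h1 h2
        rw [if_pos (Finset.mem_insert_of_mem hj), koszulSign_insert t j k hk', h1, h2,
          Finset.erase_insert_of_ne hkj, smul_smul, smul_smul, ← neg_smul]
        congr 1
        rcases lt_or_gt_of_ne hkj with h | h
        · rw [if_neg (not_lt.2 h.le), if_pos h, if_neg (lt_irrefl j)]; ring
        · rw [if_pos h, if_neg (not_lt.2 h.le), if_neg (lt_irrefl j)]; ring
      rw [Finset.sum_congr rfl key, Finset.sum_neg_distrib, ← Finset.smul_sum,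
        eq_neg_of_add_eq_zero_right hz, smul_neg, neg_neg, smul_smul, ← mul_assoc, hs, one_mul]
    · rw [Finset.sum_eq_single j]
      · rw [if_pos (Finset.mem_insert_self _ _), koszulSign_insert t j j hj, if_neg (lt_irrefl j),
          Finset.erase_insert hj, smul_smul, one_mul, mul_right_comm, hs, one_mul]
      · intro k _ hkj
        rw [if_neg, smul_zero]
        simp [hj, Ne.symm hkj]
      · intro h
        exact absurd (by simpa using hj) h

/-- The ideal generated by `f` annihilates the Koszul homology of `f`. -/
theorem koszulHomology_isTorsionBySet {R : Type u} [CommRing R] (M : Type v) [AddCommGroup M]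
    [Module R M] {n : ℕ} (f : Fin n → R) (i : ℕ) (J : Ideal R)
    (hJ : J ≤ Ideal.span (Set.range f)) :
    Module.IsTorsionBySet R (koszulHomology M f i) (J : Set R) := by
  rintro h ⟨r, hr⟩
  change r • h = 0
  have hr' := hJ hr
  have : Ideal.span (Set.range f) ≤ Module.annihilator R (koszulHomology M f i) := by
    rw [Ideal.span_le]
    rintro _ ⟨j, rfl⟩
    refine Module.mem_annihilator.2 fun h => ?_
    induction h using Submodule.Quotient.induction_on with
    | H z =>
      rw [← Submodule.Quotient.mk_smul, Submodule.Quotient.mk_eq_zero]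
      exact koszul_smul_mem_boundaries f i j z.2
  exact Module.mem_annihilator.1 (this hr') h

/-- The natural `R ⧸ J`-module structure on `H_i(f; M)`, for an ideal `J` inside the ideal
generated by `f`: the class of `r` acts as `r`. -/
abbrev koszulHomologyQuotientModule {R : Type u} [CommRing R] (M : Type v) [AddCommGroup M]
    [Module R M] {n : ℕ} (f : Fin n → R) (i : ℕ) (J : Ideal R)
    (hJ : J ≤ Ideal.span (Set.range f)) : Module (R ⧸ J) (koszulHomology M f i) :=
  (koszulHomology_isTorsionBySet M f i J hJ).module

/-- The depth of a finitely generated non-zero module over a Noetherian local ring `A`: the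
supremum of the lengths of the `M`-regular sequences in the maximal ideal (that is, consisting of
non-units). -/
noncomputable def moduleDepth (A : Type u) [CommRing A] (M : Type v) [AddCommGroup M]
    [Module A M] : ℕ∞ :=
  ⨆ (rs : List A) (_ : (∀ r ∈ rs, r ∈ nonunits A) ∧ RingTheory.Sequence.IsRegular M rs),
    (rs.length : ℕ∞)

/-- Cohen–Macaulay modules over a Noetherian local ring `A`: finitely generated modules that are
zero or have depth equal to their dimension. -/
def IsCohenMacaulayModule (A : Type u) [CommRing A] (M : Type v) [AddCommGroup M]
    [Module A M] : Prop :=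
  Module.Finite A M ∧
    (Nontrivial M → (moduleDepth A M : WithBot ℕ∞) = Module.supportDim A M)

/-- Maximal Cohen–Macaulay modules over a Noetherian local ring `A`: non-zero finitely generated
modules whose depth is the dimension of `A`. -/
def IsMaximalCohenMacaulayModule (A : Type u) [CommRing A] (M : Type v) [AddCommGroup M]
    [Module A M] : Prop :=
  Module.Finite A M ∧ Nontrivial M ∧ (moduleDepth A M : WithBot ℕ∞) = ringKrullDim A

/-- The module `M` has no non-zero free direct summand. -/
def HasNoFreeSummand (A : Type u) [CommRing A] (M : Type v) [AddCommGroup M]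
    [Module A M] : Prop :=
  ∀ N P : Submodule A M, IsCompl N P → Module.Free A N → N = ⊥

/-- `M^cm`: the sum of all `φ(L) ⊆ M`, for `L` maximal Cohen–Macaulay without non-zero free direct
summands and `φ : L → M` linear. -/
def cmPart (A : Type u) [CommRing A] (M : Type v) [AddCommGroup M] [Module A M] :
    Submodule A M :=
  sSup {N | ∃ (L : Type u) (_ : AddCommGroup L) (_ : Module A L),
    IsMaximalCohenMacaulayModule A L ∧ HasNoFreeSummand A L ∧
      ∃ φ : L →ₗ[A] M, LinearMap.range φ = N}

/-- The delta invariant of a finitely generated module over a local ring: the minimal number of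
generators of `M / M^cm`. -/
noncomputable def deltaInvariant (A : Type u) [CommRing A] (M : Type v) [AddCommGroup M]
    [Module A M] : ℕ :=
  (⊤ : Submodule A (M ⧸ cmPart A M)).spanFinrank

/-- Canonical modules of a Noetherian local ring `R` with residue field `k`: maximal
Cohen–Macaulay modules of finite injective dimension and of type `1`, the type of `ω` being the
`k`-dimension (equivalently the `R`-length) of `Ext^d_R(k, ω)`, where `d = depth ω`. -/
def IsCanonicalModule (R : Type u) [CommRing R] [IsLocalRing R] (ω : Type u) [AddCommGroup ω]
    [Module R ω] : Prop :=
  IsMaximalCohenMacaulayModule R ω ∧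
    (∃ m : ℕ, CategoryTheory.HasInjectiveDimensionLE (ModuleCat.of R ω) m) ∧
    ∃ d : ℕ, moduleDepth R ω = d ∧
      Module.length R (CategoryTheory.Abelian.Ext
        (ModuleCat.of R (IsLocalRing.ResidueField R)) (ModuleCat.of R ω) d) = 1

/-- Strongly Cohen–Macaulay ideals: all Koszul homology modules of `R` with respect to a
generating set of `I` are Cohen–Macaulay. -/
def IsStronglyCohenMacaulay {R : Type u} [CommRing R] (I : Ideal R) : Prop :=
  ∃ (n : ℕ) (f : Fin n → R), Ideal.span (Set.range f) = I ∧
    ∀ i : ℕ, IsCohenMacaulayModule R (koszulHomology R f i)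

/-- `rs` is an `R`-regular sequence in `I` that cannot be extended to a longer one in `I`. -/
def IsMaximalRegularSequenceIn {R : Type u} [CommRing R] (I : Ideal R) (rs : List R) : Prop :=
  (∀ r ∈ rs, r ∈ I) ∧ RingTheory.Sequence.IsRegular R rs ∧
    ∀ r ∈ I, ¬ RingTheory.Sequence.IsRegular R (rs ++ [r])

theorem IsMaximalRegularSequenceIn.ofList_le {R : Type u} [CommRing R] {I : Ideal R} {rs : List R}
    (h : IsMaximalRegularSequenceIn I rs) : Ideal.ofList rs ≤ I :=
  Ideal.span_le.2 h.1

/-! Write J for the ideal of the maximal regular sequence, g for its length and D for dim R/J. The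
claim is trivial when `H_i(f, R)` vanishes. Otherwise I is proper, because I annihilates the
homology, and J ≠ I: if J = I, then f is minimal, so n ≤ g, while Koszul homology vanishes above
degree n - g. The heart of the proof is that `H_i(f, R)` is then itself a maximal Cohen–Macaulay
R/J-module. An element of I outside J kills it, so it has no non-zero free summand, and the identity
map shows that `M^cm` is everything.

For the depth, take a generating set of I, with m elements, whose Koszul homology is Cohen–Macaulay.
By maximality of the sequence some associated prime p of R/J contains I, and since R/J has depth at
least D, dim R/p ≥ D. The homology in degree m - g is supported at p
(`exists_forall_not_koszulKilled`). By rigidity (`exists_koszulKilled_succ`) so is the homology in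
all lower degrees, and above m - g it vanishes. Hence every non-zero homology module has dimension,
and so depth, at least D.

To pass to the given f, "zero or depth ≥ D" is rephrased as vanishing of Koszul homology on
generators of the maximal ideal. This property is compatible with finite direct sums and summands,
and a redundant generator only replaces `H_i` by `H_i ⊕ H_{i-1}`
(`forall_koszulHomology_iff_of_span_eq`). -/

/-! ### Splitting off one element: the Koszul complex as a mapping cone. -/

section Split

variable {R : Type u} [CommRing R] {M : Type v} [AddCommGroup M] [Module R M] {n : ℕ}

/-- The subset of `Fin n` corresponding to `s` under `p.succAbove`. -/
def succAbovePreimage (p : Fin (n + 1)) (s : Finset (Fin (n + 1))) : Finset (Fin n) :=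
  {k | p.succAbove k ∈ s}

theorem notMem_map_succAboveEmb (p : Fin (n + 1)) (t : Finset (Fin n)) :
    p ∉ t.map p.succAboveEmb := by
  simp [Fin.succAbove_ne]

theorem succAbovePreimage_map (p : Fin (n + 1)) (t : Finset (Fin n)) :
    succAbovePreimage p (t.map p.succAboveEmb) = t := by
  ext k; simp [succAbovePreimage]

theorem succAbovePreimage_insert_map (p : Fin (n + 1)) (t : Finset (Fin n)) :
    succAbovePreimage p (insert p (t.map p.succAboveEmb)) = t := by
  ext k; simp [succAbovePreimage, Fin.succAbove_ne]

theorem map_succAbovePreimage {p : Fin (n + 1)} {s : Finset (Fin (n + 1))} (h : p ∉ s) :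
    (succAbovePreimage p s).map p.succAboveEmb = s := by
  ext k
  simp only [succAbovePreimage, Finset.mem_map, Finset.mem_filter, Finset.mem_univ, true_and,
    Fin.succAboveEmb_apply]
  refine ⟨fun ⟨l, hl, e⟩ => e ▸ hl, fun hk => ?_⟩
  obtain ⟨l, rfl⟩ := Fin.exists_succAbove_eq (x := k) (y := p) (fun e => h (e ▸ hk))
  exact ⟨l, hk, rfl⟩

theorem insert_map_succAbovePreimage {p : Fin (n + 1)} {s : Finset (Fin (n + 1))} (h : p ∈ s) :
    insert p ((succAbovePreimage p s).map p.succAboveEmb) = s := by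
  have h1 : succAbovePreimage p s = succAbovePreimage p (s.erase p) := by
    ext k; simp [succAbovePreimage, Fin.succAbove_ne]
  rw [h1, map_succAbovePreimage (by simp), Finset.insert_erase h]

theorem filter_lt_insert_self (p : Fin (n + 1)) (s : Finset (Fin (n + 1))) :
    (insert p s).filter (· < p) = s.filter (· < p) := by
  rw [Finset.filter_insert, if_neg (lt_irrefl p)]

theorem neg_one_pow_smul_smul (m : ℕ) (x : M) : (-1 : R) ^ m • (-1 : R) ^ m • x = x := by
  rw [smul_smul, ← mul_pow]; simp

variable (R M) in
/-- The Koszul chains on `n + 1` elements as pairs of chains on the elements other than the `p`-th: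
the coefficients of the `e_s` with `p ∉ s`, and those with `p ∈ s` after moving `e_p` to the
front. -/
def koszulSplit (p : Fin (n + 1)) :
    (Finset (Fin (n + 1)) → M) ≃ₗ[R] (Finset (Fin n) → M) × (Finset (Fin n) → M) where
  toFun φ := (fun t => φ (t.map p.succAboveEmb), fun t =>
    (-1 : R) ^ ((t.map p.succAboveEmb).filter (· < p)).card • φ (insert p (t.map p.succAboveEmb)))
  invFun ψ s := if p ∈ s then (-1 : R) ^ (s.filter (· < p)).card • ψ.2 (succAbovePreimage p s)
    else ψ.1 (succAbovePreimage p s)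
  map_add' φ ψ := by ext <;> simp
  map_smul' r φ := by ext <;> simp [smul_comm r]
  left_inv φ := by
    ext s
    by_cases h : p ∈ s
    · simp only [h, if_true]
      conv_lhs => rw [← insert_map_succAbovePreimage h]
      rw [filter_lt_insert_self, succAbovePreimage_insert_map, neg_one_pow_smul_smul,
        insert_map_succAbovePreimage h]
    · simp only [h, if_false, map_succAbovePreimage h]
  right_inv ψ := by
    ext t
    · simp only [notMem_map_succAboveEmb, if_false, succAbovePreimage_map]
    · simp only [Finset.mem_insert_self, if_true, filter_lt_insert_self,
        succAbovePreimage_insert_map, neg_one_pow_smul_smul]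

theorem compl_map_succAboveEmb (p : Fin (n + 1)) (t : Finset (Fin n)) :
    (t.map p.succAboveEmb)ᶜ = insert p (tᶜ.map p.succAboveEmb) := by
  ext k
  rcases eq_or_ne k p with rfl | h
  · simp [Fin.succAbove_ne]
  · obtain ⟨l, rfl⟩ := Fin.exists_succAbove_eq h
    simp [Fin.succAbove_ne]

theorem compl_insert_map_succAboveEmb (p : Fin (n + 1)) (t : Finset (Fin n)) :
    (insert p (t.map p.succAboveEmb))ᶜ = tᶜ.map p.succAboveEmb := by
  rw [Finset.compl_insert, compl_map_succAboveEmb,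
    Finset.erase_insert (notMem_map_succAboveEmb p _)]

theorem card_filter_map_succAboveEmb (p : Fin (n + 1)) (t : Finset (Fin n)) (k : Fin n) :
    ((t.map p.succAboveEmb).filter (· < p.succAbove k)).card = (t.filter (· < k)).card := by
  rw [Finset.filter_map, Finset.card_map]
  congr 1
  ext l
  rw [Finset.mem_filter, Finset.mem_filter]
  simp [Fin.succAbove_lt_succAbove_iff]

/-- Together with `koszulSplit_differential_snd`: K(f) is the mapping cone of multiplication by `f
p` on the complex K(f') of the remaining elements, d(a, b) = (d'a + f_p b, -d'b). -/
theorem koszulSplit_differential_fst (f : Fin (n + 1) → R) (p : Fin (n + 1))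
    (φ : Finset (Fin (n + 1)) → M) :
    (koszulSplit R M p (koszulDifferential M f φ)).1 =
      koszulDifferential M (p.removeNth f) (koszulSplit R M p φ).1 +
        f p • (koszulSplit R M p φ).2 := by
  ext t
  simp only [koszulSplit, koszulDifferential, LinearMap.coe_mk, AddHom.coe_mk,
    LinearEquiv.coe_mk, Pi.add_apply, Pi.smul_apply]
  rw [compl_map_succAboveEmb, Finset.sum_insert (notMem_map_succAboveEmb p _), Finset.sum_map,
    add_comm, smul_smul, mul_comm (f p)]
  congr 1
  refine Finset.sum_congr rfl fun k _ => ?_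
  rw [Fin.succAboveEmb_apply, card_filter_map_succAboveEmb, Finset.map_insert]
  rfl

theorem koszulSplit_differential_snd (f : Fin (n + 1) → R) (p : Fin (n + 1))
    (φ : Finset (Fin (n + 1)) → M) :
    (koszulSplit R M p (koszulDifferential M f φ)).2 =
      -koszulDifferential M (p.removeNth f) (koszulSplit R M p φ).2 := by
  ext t
  simp only [koszulSplit, koszulDifferential, LinearMap.coe_mk, AddHom.coe_mk,
    LinearEquiv.coe_mk, Pi.neg_apply]
  rw [compl_insert_map_succAboveEmb, Finset.sum_map, Finset.smul_sum, ← Finset.sum_neg_distrib]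
  refine Finset.sum_congr rfl fun k hk => ?_
  have hk' : p.succAbove k ∉ t.map p.succAboveEmb := by simpa using hk
  rw [Fin.succAboveEmb_apply, koszulSign_insert _ _ _ (notMem_map_succAboveEmb p t),
    card_filter_map_succAboveEmb, Finset.insert_comm, Finset.map_insert, Fin.succAboveEmb_apply,
    koszulSign_insert _ _ _ hk', smul_smul, smul_smul, ← neg_smul]
  congr 1
  simp only [Fin.removeNth]
  rcases lt_or_gt_of_ne (Fin.succAbove_ne p k) with h | h
  · rw [if_neg (not_lt.2 h.le), if_pos h]; ring
  · rw [if_pos h, if_neg (not_lt.2 h.le)]; ring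

theorem mem_koszulChains_succ_iff (p : Fin (n + 1)) (i : ℕ) (φ : Finset (Fin (n + 1)) → M) :
    φ ∈ koszulChains R M (n + 1) (i + 1) ↔
      (koszulSplit R M p φ).1 ∈ koszulChains R M n (i + 1) ∧
        (koszulSplit R M p φ).2 ∈ koszulChains R M n i := by
  constructor
  · intro h
    refine ⟨fun s hs => h _ (by simpa using hs), fun s hs => ?_⟩
    change _ • φ _ = 0
    rw [h, smul_zero]
    rw [Finset.card_insert_of_notMem (notMem_map_succAboveEmb p s), Finset.card_map]
    omega
  · rintro ⟨h1, h2⟩ s hs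
    by_cases hp : p ∈ s
    · have h3 := h2 (succAbovePreimage p s) (fun e => hs (by
        conv_lhs => rw [← insert_map_succAbovePreimage hp]
        rw [Finset.card_insert_of_notMem (notMem_map_succAboveEmb p _), Finset.card_map, e]))
      change (-1 : R) ^ _ • φ (insert p ((succAbovePreimage p s).map p.succAboveEmb)) = 0 at h3
      rw [insert_map_succAbovePreimage hp] at h3
      rw [← neg_one_pow_smul_smul (R := R) _ (φ s), h3, smul_zero]
    · have h3 := h1 (succAbovePreimage p s) (fun e => hs (by
        conv_lhs => rw [← map_succAbovePreimage hp]
        rw [Finset.card_map, e]))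
      change φ ((succAbovePreimage p s).map p.succAboveEmb) = 0 at h3
      rwa [map_succAbovePreimage hp] at h3

/-- Degree 0 is separate because the second component would have degree -1. -/
theorem mem_koszulChains_zero_iff (p : Fin (n + 1)) (φ : Finset (Fin (n + 1)) → M) :
    φ ∈ koszulChains R M (n + 1) 0 ↔
      (koszulSplit R M p φ).1 ∈ koszulChains R M n 0 ∧ (koszulSplit R M p φ).2 = 0 := by
  constructor
  · intro h
    refine ⟨fun s hs => h _ (by simpa using hs), ?_⟩
    ext s
    change _ • φ _ = 0
    rw [h, smul_zero]
    simp
  · rintro ⟨h1, h2⟩ s hs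
    by_cases hp : p ∈ s
    · have h3 := congrFun h2 (succAbovePreimage p s)
      change (-1 : R) ^ _ • φ (insert p ((succAbovePreimage p s).map p.succAboveEmb)) = 0 at h3
      rw [insert_map_succAbovePreimage hp] at h3
      rw [← neg_one_pow_smul_smul (R := R) _ (φ s), h3, smul_zero]
    · have h3 := h1 (succAbovePreimage p s) (fun e => hs (by
        conv_lhs => rw [← map_succAbovePreimage hp]
        rw [Finset.card_map, e]))
      change φ ((succAbovePreimage p s).map p.succAboveEmb) = 0 at h3
      rwa [map_succAbovePreimage hp] at h3

/-- Exterior multiplication by the `p`-th basis vector. -/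
def koszulWedge (R : Type u) [CommRing R] (M : Type v) [AddCommGroup M] [Module R M]
    (p : Fin (n + 1)) : (Finset (Fin (n + 1)) → M) →ₗ[R] (Finset (Fin (n + 1)) → M) :=
  (koszulSplit R M p).symm.toLinearMap ∘ₗ LinearMap.inr R _ _ ∘ₗ LinearMap.fst R _ _ ∘ₗ
    (koszulSplit R M p).toLinearMap

theorem koszulSplit_wedge (p : Fin (n + 1)) (φ : Finset (Fin (n + 1)) → M) :
    koszulSplit R M p (koszulWedge R M p φ) = (0, (koszulSplit R M p φ).1) := by
  simp [koszulWedge]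

/-- In split coordinates the wedge is (a, b) ↦ (0, a); the terms ±d'a cancel. -/
theorem koszulDifferential_wedge (f : Fin (n + 1) → R) (p : Fin (n + 1))
    (φ : Finset (Fin (n + 1)) → M) :
    koszulDifferential M f (koszulWedge R M p φ) + koszulWedge R M p (koszulDifferential M f φ) =
      f p • φ := by
  apply (koszulSplit R M p).injective
  rw [map_add, koszulSplit_wedge, map_smul]
  refine Prod.ext ?_ ?_
  · rw [Prod.fst_add, koszulSplit_differential_fst, koszulSplit_wedge]
    simp
  · rw [Prod.snd_add, koszulSplit_differential_snd, koszulSplit_wedge,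
      koszulSplit_differential_fst]
    simp

theorem koszulWedge_mem_chains (p : Fin (n + 1)) (i : ℕ) {φ : Finset (Fin (n + 1)) → M}
    (h : φ ∈ koszulChains R M (n + 1) i) :
    koszulWedge R M p φ ∈ koszulChains R M (n + 1) (i + 1) := by
  rw [mem_koszulChains_succ_iff p, koszulSplit_wedge]
  refine ⟨zero_mem _, ?_⟩
  cases i with
  | zero => exact ((mem_koszulChains_zero_iff p φ).1 h).1
  | succ i => exact ((mem_koszulChains_succ_iff p i φ).1 h).1

/-- If `a` lies in the ideal generated by `f`, multiplication by `a` on the Koszul complex of `f` is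
null-homotopic. -/
theorem exists_koszul_homotopy (M : Type v) [AddCommGroup M] [Module R M] (f : Fin n → R) {a : R}
    (ha : a ∈ Ideal.span (Set.range f)) :
    ∃ h : (Finset (Fin n) → M) →ₗ[R] (Finset (Fin n) → M),
      (∀ φ, koszulDifferential M f (h φ) + h (koszulDifferential M f φ) = a • φ) ∧
        ∀ i, ∀ φ ∈ koszulChains R M n i, h φ ∈ koszulChains R M n (i + 1) := by
  obtain ⟨c, rfl⟩ := (Ideal.mem_span_range_iff_exists_fun).1 ha
  cases n with
  | zero => exact ⟨0, by simp, fun i φ _ => zero_mem _⟩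
  | succ n =>
    refine ⟨∑ p, c p • koszulWedge R M p, fun φ => ?_, fun i φ hφ => ?_⟩
    · simp only [LinearMap.sum_apply, LinearMap.smul_apply, map_sum, map_smul,
        ← Finset.sum_add_distrib, Finset.sum_smul, ← smul_add, koszulDifferential_wedge, smul_smul]
    · rw [LinearMap.sum_apply]
      exact sum_mem fun p _ => Submodule.smul_mem _ _ (koszulWedge_mem_chains p i hφ)

theorem koszulDifferential_mem_chains (f : Fin n → R) (i : ℕ) {φ : Finset (Fin n) → M}
    (h : φ ∈ koszulChains R M n (i + 1)) : koszulDifferential M f φ ∈ koszulChains R M n i :=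
  (koszulBoundaries_le_koszulCycles M f i ⟨φ, h, rfl⟩).1

theorem koszulDifferential_eq_zero (f : Fin n → R) {φ : Finset (Fin n) → M}
    (h : φ ∈ koszulChains R M n 0) : koszulDifferential M f φ = 0 := by
  ext t
  refine Finset.sum_eq_zero fun j _ => ?_
  rw [h, smul_zero]
  simp

end Split

/-! ### Independence of the generating set, up to direct sums. -/

section Generators

variable {R : Type u} [CommRing R] {M : Type v} [AddCommGroup M] [Module R M] {n : ℕ}

/-- Multiplication by a redundant `f p` is null-homotopic on K(f'), say via h. The shear (a, b) ↦ (a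
+ h b, b) turns the mapping cone into the direct sum of K(f') and its shift. -/
theorem exists_koszulSplit_of_mem_span (f : Fin (n + 1) → R) (p : Fin (n + 1))
    (hp : f p ∈ Ideal.span (Set.range (p.removeNth f))) :
    ∃ T : (Finset (Fin (n + 1)) → M) ≃ₗ[R] (Finset (Fin n) → M) × (Finset (Fin n) → M),
      (∀ φ, (T (koszulDifferential M f φ)).1 = koszulDifferential M (p.removeNth f) (T φ).1) ∧
      (∀ φ, (T (koszulDifferential M f φ)).2 = -koszulDifferential M (p.removeNth f) (T φ).2) ∧
      (∀ i φ, φ ∈ koszulChains R M (n + 1) (i + 1) ↔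
        (T φ).1 ∈ koszulChains R M n (i + 1) ∧ (T φ).2 ∈ koszulChains R M n i) ∧
      (∀ φ, φ ∈ koszulChains R M (n + 1) 0 ↔ (T φ).1 ∈ koszulChains R M n 0 ∧ (T φ).2 = 0) := by
  obtain ⟨h, h1, h2⟩ := exists_koszul_homotopy M (p.removeNth f) hp
  let S : ((Finset (Fin n) → M) × (Finset (Fin n) → M)) ≃ₗ[R]
      (Finset (Fin n) → M) × (Finset (Fin n) → M) :=
    { toFun := fun x => (x.1 + h x.2, x.2)
      invFun := fun x => (x.1 - h x.2, x.2)
      map_add' := fun x y => by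
        refine Prod.ext ?_ rfl
        simp only [Prod.fst_add, Prod.snd_add, map_add]; abel
      map_smul' := fun r x => by simp
      left_inv := fun x => by simp
      right_inv := fun x => by simp }
  have hS1 : ∀ φ, ((koszulSplit R M p).trans S φ).1 =
    (koszulSplit R M p φ).1 + h (koszulSplit R M p φ).2 := fun _ => rfl
  have hS2 : ∀ φ, ((koszulSplit R M p).trans S φ).2 = (koszulSplit R M p φ).2 := fun _ => rfl
  refine ⟨(koszulSplit R M p).trans S, fun φ => ?_, fun φ => ?_, fun i φ => ?_, fun φ => ?_⟩
  · rw [hS1, hS1, koszulSplit_differential_fst, koszulSplit_differential_snd, map_add, map_neg,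
      ← h1]
    abel
  · rw [hS2, hS2, koszulSplit_differential_snd]
  · rw [hS1, hS2, mem_koszulChains_succ_iff p]
    refine and_congr_left fun h3 => (Submodule.add_mem_iff_left _ (h2 i _ h3)).symm
  · rw [hS1, hS2, mem_koszulChains_zero_iff p]
    refine and_congr_left fun h3 => ?_
    rw [h3, map_zero, add_zero]

/-- A linear equivalence onto a product which matches subquotients induces an equivalence of these
subquotients. -/
theorem nonempty_subquotient_prod_equiv {V V₁ V₂ : Type*} [AddCommGroup V] [Module R V]
    [AddCommGroup V₁] [Module R V₁] [AddCommGroup V₂] [Module R V₂] (T : V ≃ₗ[R] V₁ × V₂)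
    {Z B : Submodule R V} {Z₁ B₁ : Submodule R V₁} {Z₂ B₂ : Submodule R V₂}
    (hZ : ∀ x, x ∈ Z ↔ (T x).1 ∈ Z₁ ∧ (T x).2 ∈ Z₂)
    (hB : ∀ x, x ∈ B ↔ (T x).1 ∈ B₁ ∧ (T x).2 ∈ B₂) :
    Nonempty ((Z ⧸ B.submoduleOf Z) ≃ₗ[R] (Z₁ ⧸ B₁.submoduleOf Z₁) × (Z₂ ⧸ B₂.submoduleOf Z₂)) := by
  let q₁ : Z →ₗ[R] Z₁ := LinearMap.codRestrict Z₁
    (LinearMap.fst R V₁ V₂ ∘ₗ T.toLinearMap ∘ₗ Z.subtype) fun x => ((hZ x).1 x.2).1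
  let q₂ : Z →ₗ[R] Z₂ := LinearMap.codRestrict Z₂
    (LinearMap.snd R V₁ V₂ ∘ₗ T.toLinearMap ∘ₗ Z.subtype) fun x => ((hZ x).1 x.2).2
  let q : Z →ₗ[R] (Z₁ ⧸ B₁.submoduleOf Z₁) × (Z₂ ⧸ B₂.submoduleOf Z₂) :=
    ((B₁.submoduleOf Z₁).mkQ ∘ₗ q₁).prod ((B₂.submoduleOf Z₂).mkQ ∘ₗ q₂)
  have hq : Function.Surjective q := by
    rintro ⟨x, y⟩
    obtain ⟨x, rfl⟩ := Submodule.mkQ_surjective _ x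
    obtain ⟨y, rfl⟩ := Submodule.mkQ_surjective _ y
    refine ⟨⟨T.symm (x, y), (hZ _).2 (by simp)⟩, Prod.ext ?_ ?_⟩
    · change (B₁.submoduleOf Z₁).mkQ (q₁ _) = _
      refine congrArg _ (Subtype.ext ?_)
      change (T (T.symm _)).1 = _
      rw [T.apply_symm_apply]
    · change (B₂.submoduleOf Z₂).mkQ (q₂ _) = _
      refine congrArg _ (Subtype.ext ?_)
      change (T (T.symm _)).2 = _
      rw [T.apply_symm_apply]
  have hk : LinearMap.ker q = B.submoduleOf Z := by
    ext x
    rw [LinearMap.mem_ker, Prod.ext_iff]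
    change (B₁.submoduleOf Z₁).mkQ (q₁ x) = 0 ∧ (B₂.submoduleOf Z₂).mkQ (q₂ x) = 0 ↔ (x : V) ∈ B
    rw [hB, Submodule.mkQ_apply, Submodule.mkQ_apply, Submodule.Quotient.mk_eq_zero,
      Submodule.Quotient.mk_eq_zero]
    rfl
  exact ⟨(Submodule.quotEquivOfEq _ _ hk.symm).trans (q.quotKerEquivOfSurjective hq)⟩

theorem nonempty_koszulHomology_succ_equiv (f : Fin (n + 1) → R) (p : Fin (n + 1))
    (hp : f p ∈ Ideal.span (Set.range (p.removeNth f))) (i : ℕ) :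
    Nonempty (koszulHomology M f (i + 1) ≃ₗ[R]
      koszulHomology M (p.removeNth f) (i + 1) × koszulHomology M (p.removeNth f) i) := by
  obtain ⟨T, h1, h2, h3, -⟩ := exists_koszulSplit_of_mem_span (M := M) f p hp
  refine nonempty_subquotient_prod_equiv T (fun x => ?_) (fun x => ?_)
  · simp only [koszulCycles, Submodule.mem_inf, LinearMap.mem_ker, h3]
    rw [← T.map_eq_zero_iff, Prod.ext_iff, h1, h2, Prod.fst_zero, Prod.snd_zero, neg_eq_zero]
    tauto
  · constructor
    · rintro ⟨φ, hφ, rfl⟩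
      have := (h3 _ _).1 hφ
      exact ⟨⟨_, this.1, (h1 φ).symm⟩, ⟨_, neg_mem this.2, by rw [h2, map_neg]⟩⟩
    · rintro ⟨⟨φ, hφ, e1⟩, ⟨ψ, hψ, e2⟩⟩
      refine ⟨T.symm (φ, -ψ), (h3 _ _).2 ?_, T.injective (Prod.ext ?_ ?_)⟩
      · rw [T.apply_symm_apply]; exact ⟨hφ, neg_mem hψ⟩
      · rw [h1, T.apply_symm_apply, e1]
      · rw [h2, T.apply_symm_apply, map_neg, neg_neg, e2]

theorem nonempty_koszulHomology_zero_equiv (f : Fin (n + 1) → R) (p : Fin (n + 1))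
    (hp : f p ∈ Ideal.span (Set.range (p.removeNth f))) :
    Nonempty (koszulHomology M f 0 ≃ₗ[R] koszulHomology M (p.removeNth f) 0) := by
  obtain ⟨T, h1, h2, h3, h4⟩ := exists_koszulSplit_of_mem_span (M := M) f p hp
  -- The shifted summand has nothing in degree -1, hence the second factor `⊥` over `⊥`.
  obtain ⟨e⟩ := nonempty_subquotient_prod_equiv (Z := koszulCycles M f 0)
    (B := koszulBoundaries M f 0) (Z₁ := koszulCycles M (p.removeNth f) 0)
    (B₁ := koszulBoundaries M (p.removeNth f) 0) (Z₂ := ⊥) (B₂ := ⊥) T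
    (fun x => by
      simp only [koszulCycles, Submodule.mem_inf, LinearMap.mem_ker, h4, Submodule.mem_bot]
      rw [← T.map_eq_zero_iff, Prod.ext_iff, h1, h2, Prod.fst_zero, Prod.snd_zero, neg_eq_zero]
      refine ⟨fun h => ⟨⟨h.1.1, h.2.1⟩, h.1.2⟩, fun h => ⟨⟨h.1.1, h.2⟩, h.1.2, ?_⟩⟩
      rw [h.2, map_zero])
    (fun x => by
      constructor
      · rintro ⟨φ, hφ, rfl⟩
        have h5 := (h3 _ _).1 hφ
        refine ⟨⟨_, h5.1, (h1 φ).symm⟩, ?_⟩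
        rw [Submodule.mem_bot, h2, koszulDifferential_eq_zero _ h5.2, neg_zero]
      · rintro ⟨⟨φ, hφ, e1⟩, e2⟩
        refine ⟨T.symm (φ, 0), (h3 _ _).2 ?_, T.injective (Prod.ext ?_ ?_)⟩
        · rw [T.apply_symm_apply]; exact ⟨hφ, zero_mem _⟩
        · rw [h1, T.apply_symm_apply, e1]
        · rw [h2, T.apply_symm_apply, map_zero, neg_zero]; exact ((Submodule.mem_bot R).1 e2).symm)
  have : Subsingleton ((⊥ : Submodule R (Finset (Fin n) → M)) ⧸
      (⊥ : Submodule R (Finset (Fin n) → M)).submoduleOf ⊥) :=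
    (Submodule.mkQ_surjective _).subsingleton
  exact ⟨e.trans (LinearEquiv.ofBijective (LinearMap.fst R _ _)
    ⟨fun x y h => Prod.ext h (Subsingleton.elim _ _), LinearMap.fst_surjective⟩)⟩

variable (P : ∀ (N : Type v) [AddCommGroup N] [Module R N], Prop)

/-- A property of modules which is invariant under isomorphisms and holds for a product iff it holds
for the factors is inherited by all Koszul homology modules when redundant elements are added to or
removed from the sequence. -/
theorem forall_koszulHomology_removeNth_iff
    (hP : ∀ (N N' : Type v) [AddCommGroup N] [Module R N] [AddCommGroup N'] [Module R N'],
      (N ≃ₗ[R] N') → P N → P N')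
    (hP' : ∀ (N N' : Type v) [AddCommGroup N] [Module R N] [AddCommGroup N'] [Module R N'],
      P (N × N') ↔ P N ∧ P N')
    (f : Fin (n + 1) → R) (p : Fin (n + 1))
    (hp : f p ∈ Ideal.span (Set.range (p.removeNth f))) :
    (∀ i, P (koszulHomology M f i)) ↔ ∀ i, P (koszulHomology M (p.removeNth f) i) := by
  obtain ⟨e0⟩ := nonempty_koszulHomology_zero_equiv (M := M) f p hp
  constructor
  · intro h i
    cases i with
    | zero => exact hP _ _ e0 (h 0)
    | succ i =>
      obtain ⟨e⟩ := nonempty_koszulHomology_succ_equiv (M := M) f p hp i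
      exact ((hP' _ _).1 (hP _ _ e (h (i + 1)))).1
  · intro h i
    cases i with
    | zero => exact hP _ _ e0.symm (h 0)
    | succ i =>
      obtain ⟨e⟩ := nonempty_koszulHomology_succ_equiv (M := M) f p hp i
      exact hP _ _ e.symm ((hP' _ _).2 ⟨h (i + 1), h i⟩)

/-- The terms outside the range of `e` are removed one at a time. Strict monotonicity makes `e` the
identity once none is left, so permutations of the sequence never arise. -/
theorem forall_koszulHomology_comp_iff
    (hP : ∀ (N N' : Type v) [AddCommGroup N] [Module R N] [AddCommGroup N'] [Module R N'],
      (N ≃ₗ[R] N') → P N → P N')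
    (hP' : ∀ (N N' : Type v) [AddCommGroup N] [Module R N] [AddCommGroup N'] [Module R N'],
      P (N × N') ↔ P N ∧ P N') {k : ℕ} :
    ∀ {m : ℕ} (f : Fin m → R) (e : Fin k → Fin m), StrictMono e →
      Set.range f ⊆ Ideal.span (Set.range (f ∘ e)) →
      ((∀ i, P (koszulHomology M f i)) ↔ ∀ i, P (koszulHomology M (f ∘ e) i))
  | 0, f, e, he, h => by
    obtain rfl : k = 0 := by
      by_contra hk
      exact (e ⟨0, Nat.pos_of_ne_zero hk⟩).elim0
    obtain rfl : e = id := funext fun i => i.elim0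
    rfl
  | m + 1, f, e, he, h => by
    by_cases hs : Function.Surjective e
    · obtain rfl : k = m + 1 := by
        simpa using Fintype.card_of_bijective ⟨he.injective, hs⟩
      obtain rfl : e = id := funext fun i => by
        have h2 : (he.orderIsoOfSurjective e hs) = OrderIso.refl _ := Subsingleton.elim _ _
        exact congrArg (fun o : Fin (m + 1) ≃o Fin (m + 1) => o i) h2
      rfl
    · obtain ⟨p, hp⟩ := not_forall.1 hs
      have : ∀ i, ∃ j, p.succAbove j = e i := fun i =>
        Fin.exists_succAbove_eq fun e' => hp ⟨i, e'⟩
      choose e' he' using this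
      have hfe : f ∘ e = p.removeNth f ∘ e' := by
        ext i; simp [Fin.removeNth, he']
      rw [hfe] at h ⊢
      rw [← forall_koszulHomology_comp_iff hP hP' (p.removeNth f) e' (fun i j hij => ?_) ?_]
      · refine forall_koszulHomology_removeNth_iff P hP hP' f p ?_
        exact Ideal.span_mono (Set.range_comp_subset_range _ _) (h ⟨p, rfl⟩)
      · exact (Set.range_comp_subset_range p.succAbove f).trans h
      · rw [← (Fin.strictMono_succAbove p).lt_iff_lt, he', he']; exact he hij

/-- Both sequences are compared with their concatenation, in which either half is redundant. -/
theorem forall_koszulHomology_iff_of_span_eq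
    (hP : ∀ (N N' : Type v) [AddCommGroup N] [Module R N] [AddCommGroup N'] [Module R N'],
      (N ≃ₗ[R] N') → P N → P N')
    (hP' : ∀ (N N' : Type v) [AddCommGroup N] [Module R N] [AddCommGroup N'] [Module R N'],
      P (N × N') ↔ P N ∧ P N') {m : ℕ} (f : Fin m → R) (g : Fin n → R)
    (h : Ideal.span (Set.range f) = Ideal.span (Set.range g)) :
    (∀ i, P (koszulHomology M f i)) ↔ ∀ i, P (koszulHomology M g i) := by
  have hf : Fin.append f g ∘ Fin.castAdd n = f := by ext; simp
  have hg : Fin.append f g ∘ Fin.natAdd m = g := by ext; simp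
  have hr : Set.range (Fin.append f g) ⊆ Ideal.span (Set.range f) := by
    rintro _ ⟨i, rfl⟩
    induction i using Fin.addCases with
    | left i => rw [Fin.append_left]; exact Ideal.subset_span ⟨i, rfl⟩
    | right i => rw [Fin.append_right, h]; exact Ideal.subset_span ⟨i, rfl⟩
  have h1 := forall_koszulHomology_comp_iff (M := M) P hP hP' (Fin.append f g) (Fin.castAdd n)
    (Fin.strictMono_castAdd n) (by rwa [hf])
  have h2 := forall_koszulHomology_comp_iff (M := M) P hP hP' (Fin.append f g) (Fin.natAdd m)
    (Fin.strictMono_natAdd m) (by rwa [hg, ← h])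
  rw [hf] at h1
  rw [hg] at h2
  exact h1.symm.trans h2

end Generators

/-! ### Annihilators of Koszul homology and reduction modulo regular elements. -/

section Killed

open scoped Pointwise

variable {R : Type u} [CommRing R] {M : Type v} [AddCommGroup M] [Module R M] {n : ℕ}

theorem mem_koszulCycles_iff (f : Fin n → R) (i : ℕ) (φ : Finset (Fin n) → M) :
    φ ∈ koszulCycles M f i ↔ φ ∈ koszulChains R M n i ∧ koszulDifferential M f φ = 0 :=
  Iff.rfl

/-- The element `s` annihilates the Koszul homology `H_i(f; M)`. -/
def KoszulKilled (M : Type v) [AddCommGroup M] [Module R M] (f : Fin n → R) (s : R) (i : ℕ) :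
    Prop :=
  ∀ z ∈ koszulCycles M f i, s • z ∈ koszulBoundaries M f i

theorem koszulKilled_iff (f : Fin n → R) (s : R) (i : ℕ) :
    KoszulKilled M f s i ↔ ∀ h : koszulHomology M f i, s • h = 0 := by
  constructor
  · intro h x
    obtain ⟨z, rfl⟩ := Submodule.mkQ_surjective _ x
    rw [← map_smul, Submodule.mkQ_apply, Submodule.Quotient.mk_eq_zero]
    exact h z z.2
  · intro h z hz
    have := h (Submodule.mkQ _ ⟨z, hz⟩)
    rwa [← map_smul, Submodule.mkQ_apply, Submodule.Quotient.mk_eq_zero] at this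

theorem koszulKilled_one_iff (f : Fin n → R) (i : ℕ) :
    KoszulKilled M f 1 i ↔ Subsingleton (koszulHomology M f i) := by
  rw [koszulKilled_iff, subsingleton_iff_forall_eq 0]
  simp only [one_smul]

theorem koszulDifferential_compLeft {N : Type*} [AddCommGroup N] [Module R N] (f : Fin n → R)
    (l : M →ₗ[R] N) (φ : Finset (Fin n) → M) :
    koszulDifferential N f (l.compLeft _ φ) = l.compLeft _ (koszulDifferential M f φ) := by
  ext t
  simp [koszulDifferential]

theorem compLeft_mem_koszulChains {N : Type*} [AddCommGroup N] [Module R N] (l : M →ₗ[R] N)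
    {i : ℕ} {φ : Finset (Fin n) → M} (h : φ ∈ koszulChains R M n i) :
    l.compLeft _ φ ∈ koszulChains R N n i := fun s hs => by
  simp [h s hs]

theorem compLeft_mem_koszulCycles {N : Type*} [AddCommGroup N] [Module R N] (f : Fin n → R)
    (l : M →ₗ[R] N) {i : ℕ} {φ : Finset (Fin n) → M} (h : φ ∈ koszulCycles M f i) :
    l.compLeft _ φ ∈ koszulCycles N f i :=
  (mem_koszulCycles_iff _ _ _).2 ⟨compLeft_mem_koszulChains l h.1, by
    rw [koszulDifferential_compLeft, LinearMap.mem_ker.1 h.2, map_zero]⟩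

theorem compLeft_mem_koszulBoundaries {N : Type*} [AddCommGroup N] [Module R N] (f : Fin n → R)
    (l : M →ₗ[R] N) {i : ℕ} {φ : Finset (Fin n) → M} (h : φ ∈ koszulBoundaries M f i) :
    l.compLeft _ φ ∈ koszulBoundaries N f i := by
  obtain ⟨ψ, hψ, rfl⟩ := h
  exact ⟨_, compLeft_mem_koszulChains l hψ, koszulDifferential_compLeft f l ψ⟩

theorem KoszulKilled.of_retract {N : Type*} [AddCommGroup N] [Module R N] {f : Fin n → R} {s : R}
    {i : ℕ} (h : KoszulKilled M f s i) (l : N →ₗ[R] M) (r : M →ₗ[R] N) (hr : ∀ x, r (l x) = x) :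
    KoszulKilled N f s i := by
  intro z hz
  have h1 := compLeft_mem_koszulBoundaries f r (h _ (compLeft_mem_koszulCycles f l hz))
  convert h1 using 1
  ext t
  simp [hr]

theorem KoszulKilled.of_equiv {N : Type*} [AddCommGroup N] [Module R N] {f : Fin n → R} {s : R}
    {i : ℕ} (h : KoszulKilled M f s i) (e : M ≃ₗ[R] N) : KoszulKilled N f s i :=
  h.of_retract e.symm.toLinearMap e.toLinearMap e.apply_symm_apply

theorem koszulKilled_prod_iff {N : Type*} [AddCommGroup N] [Module R N] (f : Fin n → R) (s : R)
    (i : ℕ) : KoszulKilled (M × N) f s i ↔ KoszulKilled M f s i ∧ KoszulKilled N f s i := by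
  refine ⟨fun h => ⟨h.of_retract (.inl R M N) (.fst R M N) fun _ => rfl,
    h.of_retract (.inr R M N) (.snd R M N) fun _ => rfl⟩, fun ⟨h1, h2⟩ z hz => ?_⟩
  have h3 := compLeft_mem_koszulBoundaries f (LinearMap.inl R M N)
    (h1 _ (compLeft_mem_koszulCycles f (LinearMap.fst R M N) hz))
  have h4 := compLeft_mem_koszulBoundaries f (LinearMap.inr R M N)
    (h2 _ (compLeft_mem_koszulCycles f (LinearMap.snd R M N) hz))
  convert add_mem h3 h4 using 1
  ext t <;> simp

theorem koszulChains_eq_bot {i : ℕ} (hi : n < i) : koszulChains R M n i = ⊥ := by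
  rw [eq_bot_iff]
  intro φ hφ
  ext s
  refine hφ s (ne_of_lt (lt_of_le_of_lt ?_ hi))
  simpa using s.card_le_univ

theorem koszulKilled_of_lt (f : Fin n → R) (s : R) {i : ℕ} (hi : n < i) : KoszulKilled M f s i := by
  intro z hz
  have := ((mem_koszulCycles_iff _ _ _).1 hz).1
  rw [koszulChains_eq_bot hi, Submodule.mem_bot] at this
  rw [this, smul_zero]
  exact zero_mem _

theorem exists_mem_koszulChains_compLeft_eq {N : Type*} [AddCommGroup N] [Module R N]
    {l : M →ₗ[R] N} (hl : Function.Surjective l) {i : ℕ} {w : Finset (Fin n) → N}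
    (hw : w ∈ koszulChains R N n i) :
    ∃ v ∈ koszulChains R M n i, l.compLeft _ v = w := by
  choose g hg using hl
  refine ⟨fun s => if s.card = i then g (w s) else 0, fun s hs => if_neg hs, ?_⟩
  ext s
  by_cases hs : s.card = i
  · simp [hs, hg]
  · simp [hs, hw s hs]

theorem exists_mem_koszulChains_smul_eq {x : R} {i : ℕ} {w : Finset (Fin n) → M}
    (hw : w ∈ koszulChains R M n i)
    (h : (x • (⊤ : Submodule R M)).mkQ.compLeft _ w = 0) :
    ∃ v ∈ koszulChains R M n i, x • v = w := by
  have : ∀ s, ∃ y, x • y = w s := fun s => by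
    have h1 := congrFun h s
    simp only [LinearMap.compLeft_apply, Function.comp_apply, Submodule.mkQ_apply, Pi.zero_apply,
      Submodule.Quotient.mk_eq_zero, Submodule.mem_smul_pointwise_iff_exists] at h1
    obtain ⟨y, -, hy⟩ := h1
    exact ⟨y, hy⟩
  choose g hg using this
  refine ⟨fun s => if s.card = i then g s else 0, fun s hs => if_neg hs, ?_⟩
  ext s
  by_cases hs : s.card = i
  · simp [hs, hg]
  · simp [hs, hw s hs]

theorem compLeft_mkQ_smul (x : R) (φ : Finset (Fin n) → M) :
    (x • (⊤ : Submodule R M)).mkQ.compLeft (Finset (Fin n)) (x • φ) = 0 := by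
  ext s
  simp only [LinearMap.compLeft_apply, Function.comp_apply, Submodule.mkQ_apply, Pi.zero_apply,
    Pi.smul_apply, Submodule.Quotient.mk_eq_zero]
  exact Submodule.smul_mem_pointwise_smul _ _ _ trivial

theorem smul_injective_of_isSMulRegular {x : R} (hx : IsSMulRegular M x) {φ ψ : Finset (Fin n) → M}
    (h : x • φ = x • ψ) : φ = ψ :=
  funext fun s => hx (congrFun h s)

/-- As x lies in (f), it kills `H_i(f; M)`, so the connecting map from `H_{i+1}(f; M/xM)` to `H_i(f;
M)` is onto. Concretely, the homotopy lifts a cycle z to w with dw = xz; then sw = du + xv, and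
applying d and cancelling x gives sz = dv. -/
theorem KoszulKilled.of_quotSMulTop_succ {f : Fin n → R} {x s : R} {i : ℕ}
    (hx : IsSMulRegular M x) (hxf : x ∈ Ideal.span (Set.range f))
    (h : KoszulKilled (QuotSMulTop x M) f s (i + 1)) : KoszulKilled M f s i := by
  intro z hz
  obtain ⟨η, h1, h2⟩ := exists_koszul_homotopy M f hxf
  have hw := h1 z
  rw [LinearMap.mem_ker.1 hz.2, map_zero, add_zero] at hw
  have hwc := h2 i z hz.1
  set w := η z
  obtain ⟨u, hu, e⟩ := h ((x • (⊤ : Submodule R M)).mkQ.compLeft _ w)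
    ((mem_koszulCycles_iff _ _ _).2 ⟨compLeft_mem_koszulChains _ hwc, by
      rw [koszulDifferential_compLeft, hw, compLeft_mkQ_smul]⟩)
  obtain ⟨u, hu', rfl⟩ := exists_mem_koszulChains_compLeft_eq
    (Submodule.mkQ_surjective (x • (⊤ : Submodule R M))) hu
  rw [koszulDifferential_compLeft, ← map_smul, eq_comm, ← sub_eq_zero, ← map_sub] at e
  obtain ⟨v, hv, e⟩ := exists_mem_koszulChains_smul_eq
    (sub_mem (Submodule.smul_mem _ s hwc) (koszulDifferential_mem_chains f _ hu')) e
  refine ⟨v, hv, smul_injective_of_isSMulRegular hx ?_⟩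
  rw [← map_smul, e, map_sub, koszulDifferential_sq, sub_zero, map_smul, hw, smul_comm]

/-- From the exact sequence `H_{i+1}(M) → H_{i+1}(M/xM) → H_i(M)`: annihilators of the outer terms
multiply to one of the middle term. -/
theorem KoszulKilled.quotSMulTop_succ {f : Fin n → R} {x s t : R} {i : ℕ}
    (hx : IsSMulRegular M x) (h : KoszulKilled M f s i) (h' : KoszulKilled M f t (i + 1)) :
    KoszulKilled (QuotSMulTop x M) f (t * s) (i + 1) := by
  intro w hw
  obtain ⟨w, hwc, rfl⟩ := exists_mem_koszulChains_compLeft_eq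
    (Submodule.mkQ_surjective (x • (⊤ : Submodule R M))) hw.1
  have e := ((mem_koszulCycles_iff _ _ _).1 hw).2
  rw [koszulDifferential_compLeft] at e
  obtain ⟨z, hz, e⟩ :=
    exists_mem_koszulChains_smul_eq (koszulDifferential_mem_chains f _ hwc) e
  obtain ⟨v, hv, e2⟩ := h z <| (mem_koszulCycles_iff _ _ _).2 ⟨hz, smul_injective_of_isSMulRegular hx <| by
    rw [← map_smul, e, koszulDifferential_sq, smul_zero]⟩
  obtain ⟨u, hu, e3⟩ := h' (s • w - x • v)
    ((mem_koszulCycles_iff _ _ _).2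
      ⟨sub_mem (Submodule.smul_mem _ s hwc) (Submodule.smul_mem _ x hv), by
        rw [map_sub, map_smul, map_smul, e2, ← e, smul_comm, sub_self]⟩)
  refine ⟨_, compLeft_mem_koszulChains (x • (⊤ : Submodule R M)).mkQ hu, ?_⟩
  rw [koszulDifferential_compLeft, e3, smul_sub, smul_comm t x, map_sub, compLeft_mkQ_smul,
    sub_zero, smul_smul, map_smul]

theorem KoszulKilled.quotSMulTop_zero {f : Fin n → R} (x : R) {s : R} (h : KoszulKilled M f s 0) :
    KoszulKilled (QuotSMulTop x M) f s 0 := by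
  intro w hw
  obtain ⟨w, hwc, rfl⟩ := exists_mem_koszulChains_compLeft_eq
    (Submodule.mkQ_surjective (x • (⊤ : Submodule R M))) hw.1
  rw [← map_smul]
  exact compLeft_mem_koszulBoundaries f _ (h w ⟨hwc, koszulDifferential_eq_zero f hwc⟩)

open RingTheory.Sequence in
/-- Koszul homology vanishes above degree `n - g` if `(f₁, …, fₙ)` contains a weakly regular
sequence of length `g`. -/
theorem koszulKilled_of_isWeaklyRegular {f : Fin n → R} {rs : List R} (h : IsWeaklyRegular M rs)
    (hrs : ∀ r ∈ rs, r ∈ Ideal.span (Set.range f)) {i : ℕ} (hi : n < i + rs.length) :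
    KoszulKilled M f 1 i := by
  induction h generalizing i with
  | nil => exact koszulKilled_of_lt f 1 hi
  | cons r rs h1 h2 ih =>
    -- The degree goes up by one while the sequence loses one term, so the bound is preserved.
    refine KoszulKilled.of_quotSMulTop_succ h1 (hrs r (by simp)) (ih ?_ ?_)
    · exact fun r' hr' => hrs r' (by simp [hr'])
    · rw [List.length_cons] at hi; omega

/-- Killing a weakly regular sequence of length `g` raises the degrees where Koszul homology may be
non-zero by at most `g`. -/
theorem koszulKilled_quotient_of_isWeaklyRegular {f : Fin n → R} {rs : List R}
    (h : RingTheory.Sequence.IsWeaklyRegular M rs) {a b : ℕ}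
    (hM : ∀ i, a < i + (b + rs.length) → KoszulKilled M f 1 i) {i : ℕ} (hi : a < i + b) :
    KoszulKilled (M ⧸ (Ideal.ofList rs • ⊤ : Submodule R M)) f 1 i := by
  induction h generalizing i with
  | nil =>
    refine (hM i hi).of_equiv (Submodule.quotEquivOfEqBot _ ?_).symm
    rw [Ideal.ofList_nil, Submodule.bot_smul]
  | cons r rs h1 h2 ih =>
    simp only [List.length_cons] at hM
    refine (ih (fun i hi => ?_) hi).of_equiv
      (Submodule.quotOfListConsSMulTopEquivQuotSMulTopInner _ r rs).symm
    -- `H_{i+1}(M/rM)` involves both `H_{i+1}(M)` and `H_i(M)`; the lower degree uses up one unit of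
    -- the bound.
    cases i with
    | zero => exact (hM 0 (by omega)).quotSMulTop_zero r
    | succ i => simpa using (hM i (by omega)).quotSMulTop_succ h1 (hM (i + 1) (by omega))

end Killed

/-! ### Support and rigidity of Koszul homology. -/

section Rigidity

open scoped Pointwise

variable {R : Type u} [CommRing R] [IsNoetherianRing R] {M : Type v} [AddCommGroup M] [Module R M]
  [Module.Finite R M]

/-- The homology is finitely generated, so its localization at p vanishes exactly when a single
element outside p annihilates it. -/
theorem mem_support_koszulHomology_iff {n : ℕ} (f : Fin n → R) (i : ℕ) (p : PrimeSpectrum R) :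
    p ∈ Module.support R (koszulHomology M f i) ↔ ∀ s ∉ p.asIdeal, ¬ KoszulKilled M f s i := by
  rw [Module.mem_support_iff_of_finite]
  simp only [koszulKilled_iff, ← Module.mem_annihilator]
  exact ⟨fun h s hs hs' => hs (h hs'), fun h s hs => by_contra fun hs' => h s hs' hs⟩

/-- Rigidity of the Koszul complex, localized at a prime containing the sequence. -/
theorem exists_koszulKilled_succ (p : PrimeSpectrum R) :
    ∀ {n : ℕ} (f : Fin n → R), (∀ j, f j ∈ p.asIdeal) → ∀ i : ℕ,
      (∃ s ∉ p.asIdeal, KoszulKilled M f s i) → ∃ s ∉ p.asIdeal, KoszulKilled M f s (i + 1)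
  | 0, f, hf, i, _ => ⟨1, (Ideal.ne_top_iff_one _).1 p.2.ne_top,
      koszulKilled_of_lt f 1 (Nat.succ_pos i)⟩
  | n + 1, f, hf, i, ⟨s, hs, h⟩ => by
    set f' := (0 : Fin (n + 1)).removeNth f with hf'
    let E := koszulSplit R M (0 : Fin (n + 1))
    have hE1 : ∀ φ, (E (koszulDifferential M f φ)).1 =
      koszulDifferential M f' (E φ).1 + f 0 • (E φ).2 := koszulSplit_differential_fst f 0
    have hE2 : ∀ φ, (E (koszulDifferential M f φ)).2 = -koszulDifferential M f' (E φ).2 := koszulSplit_differential_snd f 0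
    have hE3 : ∀ j φ, φ ∈ koszulChains R M (n + 1) (j + 1) ↔
        (E φ).1 ∈ koszulChains R M n (j + 1) ∧ (E φ).2 ∈ koszulChains R M n j :=
      mem_koszulChains_succ_iff 0
    have hE4 : ∀ φ, φ ∈ koszulChains R M (n + 1) 0 ↔
        (E φ).1 ∈ koszulChains R M n 0 ∧ (E φ).2 = 0 := mem_koszulChains_zero_iff 0
    -- In the mapping cone sequence, `H_i(f)` localized at p being zero makes `f 0` surjective on
    -- the localization of `H_i(f')`. That vanishes by Nakayama, here in the form of the support of
    -- `QuotSMulTop`.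
    have key : ∃ t ∉ p.asIdeal, KoszulKilled M f' t i := by
      by_contra! hcon
      have h1 : p ∈ Module.support R (koszulHomology M f' i) :=
        (mem_support_koszulHomology_iff f' i p).2 hcon
      have h2 : p ∈ Module.support R (QuotSMulTop (f 0) (koszulHomology M f' i)) := by
        rw [Module.support_quotSMulTop]
        exact ⟨h1, by simpa using hf 0⟩
      rw [Module.mem_support_iff_of_finite] at h2
      refine hs (h2 (Module.mem_annihilator.2 fun x => ?_))
      obtain ⟨x, rfl⟩ := Submodule.mkQ_surjective _ x
      obtain ⟨z, rfl⟩ := Submodule.mkQ_surjective _ x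
      rw [← map_smul, Submodule.mkQ_apply, Submodule.Quotient.mk_eq_zero,
        Submodule.mem_smul_pointwise_iff_exists]
      have hz : E (E.symm (z, 0)) = (z.1, 0) := E.apply_symm_apply _
      have hzz := (mem_koszulCycles_iff _ _ _).1 z.2
      obtain ⟨w, hw, e⟩ := h (E.symm (z, 0)) ((mem_koszulCycles_iff _ _ _).2 ⟨by
        cases i with
        | zero => rw [hE4, hz]; exact ⟨hzz.1, rfl⟩
        | succ i => rw [hE3, hz]; exact ⟨hzz.1, zero_mem _⟩, by
        rw [← E.map_eq_zero_iff, Prod.ext_iff, hE1, hE2, hz]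
        simp [hzz.2]⟩)
      have e' := congrArg E e
      rw [map_smul, hz, Prod.ext_iff, hE1, hE2] at e'
      have hw' := (hE3 _ _).1 hw
      have hv : (E w).2 ∈ koszulCycles M f' i := (mem_koszulCycles_iff _ _ _).2 ⟨hw'.2, by
        have := e'.2
        rw [Prod.smul_snd, smul_zero, neg_eq_zero] at this
        exact this⟩
      refine ⟨Submodule.mkQ _ ⟨(E w).2, hv⟩, trivial, ?_⟩
      rw [← map_smul, ← map_smul, eq_comm, ← sub_eq_zero, ← map_sub, Submodule.mkQ_apply,
        Submodule.Quotient.mk_eq_zero]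
      refine ⟨(E w).1, hw'.1, ?_⟩
      have := e'.1
      exact eq_sub_of_add_eq this
    obtain ⟨t, ht, ht'⟩ := key
    -- By induction `H_{i+1}(f')` also vanishes at p, and `H_{i+1}(f)` sits between it and
    -- `H_i(f')`.
    obtain ⟨t', ht1, ht2⟩ := exists_koszulKilled_succ p f' (fun j => hf _) i ⟨t, ht, ht'⟩
    refine ⟨t' * t, fun hm => (p.2.mem_or_mem hm).elim ht1 ht, fun z hz => ?_⟩
    have hzc := (hE3 _ _).1 hz.1
    have hz0 := ((mem_koszulCycles_iff _ _ _).1 hz).2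
    rw [← E.map_eq_zero_iff, Prod.ext_iff, hE1, hE2] at hz0
    have hz1 : koszulDifferential M f' (E z).1 + f 0 • (E z).2 = 0 := hz0.1
    have hz2 : koszulDifferential M f' (E z).2 = 0 := neg_eq_zero.1 hz0.2
    obtain ⟨w, hw, e⟩ := ht' (E z).2 ((mem_koszulCycles_iff _ _ _).2 ⟨hzc.2, hz2⟩)
    obtain ⟨u, hu, e'⟩ := ht2 (t • (E z).1 + f 0 • w)
      ((mem_koszulCycles_iff _ _ _).2
        ⟨add_mem (Submodule.smul_mem _ t hzc.1) (Submodule.smul_mem _ _ hw), by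
          rw [map_add, map_smul, map_smul, e, smul_comm (f 0), ← smul_add, hz1, smul_zero]⟩)
    have hE5 : E (E.symm (u, -(t' • w))) = (u, -(t' • w)) := E.apply_symm_apply _
    refine ⟨E.symm (u, -(t' • w)), (hE3 _ _).2 ?_, E.injective (Prod.ext ?_ ?_)⟩
    · rw [hE5]
      exact ⟨hu, neg_mem (Submodule.smul_mem _ _ hw)⟩
    · rw [hE1, hE5, e', map_smul, mul_smul, smul_add, smul_neg, smul_comm (f 0)]
      exact add_neg_cancel_right _ _
    · rw [hE2, hE5, map_neg, neg_neg, map_smul, e, map_smul, mul_smul]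
      rfl

end Rigidity

/-! ### Depth, associated primes and Koszul homology. -/

section Depth

open RingTheory.Sequence IsLocalRing
open scoped Pointwise

variable {R : Type u} [CommRing R] {M : Type v} [AddCommGroup M] [Module R M]

/-- The top homology consists of the elements of M killed by f, as there are no boundaries in degree
n. -/
theorem smul_eq_zero_of_koszulKilled {n : ℕ} {f : Fin n → R} {s : R}
    {x : M} (hx : ∀ j, f j • x = 0) (h : KoszulKilled M f s n) : s • x = 0 := by
  have h1 := h (fun t => if t = Finset.univ then x else 0) ((mem_koszulCycles_iff _ _ _).2
    ⟨fun t ht => if_neg fun e => ht (by simp [e]), by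
      ext t
      refine Finset.sum_eq_zero fun j _ => ?_
      dsimp only
      split_ifs
      · rw [mul_smul, hx, smul_zero]
      · exact smul_zero _⟩)
  rw [koszulBoundaries, koszulChains_eq_bot (Nat.lt_succ_self n), Submodule.map_bot,
    Submodule.mem_bot] at h1
  simpa using congrFun h1 Finset.univ

theorem mem_associatedPrimes_iff_exists [IsNoetherianRing R] {p : Ideal R} :
    p ∈ associatedPrimes R M ↔ p.IsPrime ∧ ∃ x : M, ∀ r, r ∈ p ↔ r • x = 0 := by
  rw [AssociatedPrimes.mem_iff, isAssociatedPrime_iff]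
  simp only [SetLike.ext_iff, Submodule.mem_colon_singleton, Submodule.mem_bot]

/-- An ideal consisting of zero-divisors of `M` is contained in an associated prime of `M`. -/
theorem exists_associatedPrime_of_forall_not_isSMulRegular [IsNoetherianRing R] [Module.Finite R M] {I : Ideal R}
    (h : ∀ r ∈ I, ¬ IsSMulRegular M r) : ∃ p ∈ associatedPrimes R M, I ≤ p := by
  refine (Ideal.subset_union_prime_finite (associatedPrimes.finite R M) (f := id) ⊥ ⊥
    (fun p hp _ _ => hp.1)).1 ?_
  have := biUnion_associatedPrimes_eq_compl_regular R M
  simp only [id]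
  rw [this]
  exact h

/-- If `p ⊇ (f₁, …, fₙ)` is associated to `M / (rs) M` for a weakly regular sequence `rs` in
`(f₁, …, fₙ)`, then `H_{n - g}(f; M)` is supported at `p`, where `g` is the length of `rs`. -/
theorem exists_forall_not_koszulKilled [IsNoetherianRing R] {n : ℕ} {f : Fin n → R} {p : Ideal R}
    (hfp : Ideal.span (Set.range f) ≤ p) {rs : List R} (h : IsWeaklyRegular M rs)
    (hrs : ∀ r ∈ rs, r ∈ Ideal.span (Set.range f))
    (hp : p ∈ associatedPrimes R (M ⧸ (Ideal.ofList rs • ⊤ : Submodule R M))) :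
    ∃ i, i + rs.length = n ∧ ∀ s ∉ p, ¬ KoszulKilled M f s i := by
  induction h with
  | nil M =>
    refine ⟨n, rfl, fun s hs hk => ?_⟩
    have e : (M ⧸ (Ideal.ofList ([] : List R) • ⊤ : Submodule R M)) ≃ₗ[R] M :=
      Submodule.quotEquivOfEqBot _ (by rw [Ideal.ofList_nil, Submodule.bot_smul])
    rw [LinearEquiv.AssociatedPrimes.eq e, mem_associatedPrimes_iff_exists] at hp
    obtain ⟨-, x, hx⟩ := hp
    exact hs ((hx s).2 (smul_eq_zero_of_koszulKilled
      (fun j => (hx _).1 (hfp (Ideal.subset_span ⟨j, rfl⟩))) hk))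
  | @cons M _ _ r rs h1 h2 ih =>
    rw [LinearEquiv.AssociatedPrimes.eq
      (Submodule.quotOfListConsSMulTopEquivQuotSMulTopInner M r rs)] at hp
    obtain ⟨i, hi, hk⟩ := ih (fun r' hr' => hrs r' (by simp [hr'])) hp
    have h1p : (1 : R) ∉ p := (Ideal.ne_top_iff_one _).1 hp.1.ne_top
    -- Since `H_{i+1}(f; M)` vanishes in the relevant degree, `H_{i+1}(f; M/rM)` embeds into `H_i(f;
    -- M)`, so non-vanishing at p passes down one degree.
    have hv : ∀ j, n < j + rs.length + 1 → KoszulKilled M f 1 j := fun j hj =>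
      koszulKilled_of_isWeaklyRegular (h2.cons h1) hrs (by rw [List.length_cons]; omega)
    cases i with
    | zero => exact absurd ((hv 0 (by omega)).quotSMulTop_zero r) (hk 1 h1p)
    | succ i =>
      refine ⟨i, by rw [List.length_cons]; omega, fun s hs hs' => hk s hs ?_⟩
      simpa using hs'.quotSMulTop_succ h1 (hv (i + 1) (by omega))

/-- R/q is a quotient of (R/p)/(x), and x is a non-zero-divisor in the domain R/p. -/
theorem ringKrullDim_quotient_succ_le_of_lt {p q : Ideal R} [p.IsPrime] {x : R}
    (hpq : p ≤ q) (hxp : x ∉ p) (hxq : x ∈ q) :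
    ringKrullDim (R ⧸ q) + 1 ≤ ringKrullDim (R ⧸ p) := by
  have h1 : Ideal.Quotient.mk p x ∈ nonZeroDivisors (R ⧸ p) :=
    mem_nonZeroDivisors_of_ne_zero fun h => hxp (Ideal.Quotient.eq_zero_iff_mem.1 h)
  refine le_trans ?_ (ringKrullDim_quotient_succ_le_of_nonZeroDivisor h1)
  have h2 : ∀ a ∈ Ideal.span {Ideal.Quotient.mk p x}, Ideal.Quotient.factor hpq a = 0 := by
    intro a ha
    obtain ⟨b, rfl⟩ := Ideal.mem_span_singleton'.1 ha
    rw [map_mul, Ideal.Quotient.factor_mk, Ideal.Quotient.eq_zero_iff_mem.2 hxq, mul_zero]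
  have h3 := ringKrullDim_le_of_surjective (Ideal.Quotient.lift _ (Ideal.Quotient.factor hpq) h2)
    (Ideal.Quotient.lift_surjective_of_surjective _ _ (Ideal.Quotient.factor_surjective hpq))
  gcongr

variable [IsLocalRing R]

/-- The depth of a module over a Noetherian local ring is at least `D` if the Koszul homology of
generators of the maximal ideal vanishes in the top `D` degrees. -/
theorem exists_isWeaklyRegular_of_koszulKilled [IsNoetherianRing R] {k : ℕ} {y : Fin k → R}
    (hy : Ideal.span (Set.range y) = maximalIdeal R) :
    ∀ (D : ℕ) (M : Type v) [AddCommGroup M] [Module R M] [Module.Finite R M] [Nontrivial M],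
      (∀ j, k < j + D → KoszulKilled M y 1 j) →
      ∃ rs : List R, rs.length = D ∧ (∀ r ∈ rs, r ∈ maximalIdeal R) ∧ IsWeaklyRegular M rs
  | 0, M, _, _, _, _, _ => ⟨[], rfl, by simp, .nil R M⟩
  | D + 1, M, _, _, _, _, h => by
    -- Otherwise the maximal ideal is associated to M and kills a non-zero element, contradicting
    -- the vanishing of `H_k`.
    obtain ⟨r, hr, hrM⟩ : ∃ r ∈ maximalIdeal R, IsSMulRegular M r := by
      by_contra! hcon
      obtain ⟨p, hp, hmp⟩ := exists_associatedPrime_of_forall_not_isSMulRegular hcon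
      obtain ⟨hpp, x, hx⟩ := mem_associatedPrimes_iff_exists.1 hp
      have h1 := smul_eq_zero_of_koszulKilled (f := y) (s := 1) (x := x)
        (fun j => (hx _).1 (hmp (hy ▸ Ideal.subset_span ⟨j, rfl⟩))) (h k (by omega))
      exact hpp.ne_top ((Ideal.eq_top_iff_one _).2 ((hx 1).2 h1))
    have := nontrivial_quotSMulTop_of_mem_maximalIdeal M hr
    obtain ⟨rs, h1, h2, h3⟩ := exists_isWeaklyRegular_of_koszulKilled hy D (QuotSMulTop r M)
      (fun j hj => by
        cases j with
        | zero => exact (h 0 (by omega)).quotSMulTop_zero r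
        | succ j => simpa using (h j (by omega)).quotSMulTop_succ hrM (h (j + 1) (by omega)))
    exact ⟨r :: rs, by simp [h1], by simpa using ⟨hr, h2⟩, h3.cons hrM⟩

theorem le_moduleDepth [Module.Finite R M] [Nontrivial M] {rs : List R}
    (h : ∀ r ∈ rs, r ∈ maximalIdeal R) (h' : IsWeaklyRegular M rs) :
    (rs.length : ℕ∞) ≤ moduleDepth R M :=
  le_iSup₂_of_le (f := fun (rs : List R) (_ : (∀ r ∈ rs, r ∈ nonunits R) ∧ IsRegular M rs) =>
    (rs.length : ℕ∞)) rs
    ⟨h, (isRegular_iff_isWeaklyRegular_of_subset_maximalIdeal h).2 h'⟩ le_rfl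

theorem exists_isWeaklyRegular_of_le_moduleDepth {D : ℕ} (h : (D : ℕ∞) ≤ moduleDepth R M) :
    ∃ rs : List R, D ≤ rs.length ∧ (∀ r ∈ rs, r ∈ maximalIdeal R) ∧ IsWeaklyRegular M rs := by
  cases D with
  | zero => exact ⟨[], le_rfl, by simp, .nil R M⟩
  | succ D =>
    -- The supremum need not be attained, but some length strictly exceeds `D`, which is enough.
    have h1 : (D : ℕ∞) < moduleDepth R M :=
      lt_of_lt_of_le (by exact_mod_cast Nat.lt_succ_self D) h
    rw [moduleDepth] at h1
    obtain ⟨rs, h1⟩ := lt_iSup_iff.1 h1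
    obtain ⟨h2, h1⟩ := lt_iSup_iff.1 h1
    exact ⟨rs, by exact_mod_cast h1, h2.1, h2.2.toIsWeaklyRegular⟩

theorem koszulKilled_of_le_moduleDepth {k : ℕ} {y : Fin k → R}
    (hy : Ideal.span (Set.range y) = maximalIdeal R) {D : ℕ} (h : (D : ℕ∞) ≤ moduleDepth R M)
    {j : ℕ} (hj : k < j + D) : KoszulKilled M y 1 j := by
  obtain ⟨rs, h1, h2, h3⟩ := exists_isWeaklyRegular_of_le_moduleDepth h
  exact koszulKilled_of_isWeaklyRegular h3 (hy ▸ h2) (by omega)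

/-- The depth of a module is at most its dimension. -/
theorem moduleDepth_le_supportDim [IsNoetherianRing R] [Module.Finite R M] [Nontrivial M] :
    (moduleDepth R M : WithBot ℕ∞) ≤ Module.supportDim R M := by
  obtain ⟨d, hd⟩ := WithBot.ne_bot_iff_exists.1 (Module.supportDim_ne_bot_of_nontrivial R M)
  rw [← hd, WithBot.coe_le_coe]
  refine iSup₂_le fun rs h => ?_
  have h1 := Module.supportDim_add_length_eq_supportDim_of_isRegular rs h.2
  have := h.2.quot_ofList_smul_nontrivial ⊤
  obtain ⟨e, he⟩ := WithBot.ne_bot_iff_exists.1 (Module.supportDim_ne_bot_of_nontrivial R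
    (M ⧸ (Ideal.ofList rs • ⊤ : Submodule R M)))
  rw [← he, ← hd] at h1
  have h2 : e + rs.length = d := by exact_mod_cast h1
  exact h2 ▸ le_add_self

/-- The depth of `M` is at most the dimension of `R ⧸ p`, for `p` associated to `M`. -/
theorem length_le_ringKrullDim_quotient_of_mem_associatedPrimes [IsNoetherianRing R] :
    ∀ (rs : List R) (M : Type v) [AddCommGroup M] [Module R M] [Module.Finite R M] (p : Ideal R),
      (∀ r ∈ rs, r ∈ maximalIdeal R) → IsWeaklyRegular M rs → p ∈ associatedPrimes R M →
      (rs.length : WithBot ℕ∞) ≤ ringKrullDim (R ⧸ p)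
  | [], M, _, _, _, p, _, _, hp => by
    have := hp.1
    exact ringKrullDim_nonneg_of_nontrivial
  | x :: rs, M, _, _, _, p, hrs, h, hp => by
    rw [isWeaklyRegular_cons_iff] at h
    have hx : x ∈ maximalIdeal R := hrs x (by simp)
    obtain ⟨hpp, z, hz⟩ := mem_associatedPrimes_iff_exists.1 hp
    have hxp : x ∉ p := fun hxp => by
      have h0 : z = 0 := h.1 (by simpa using (hz x).1 hxp)
      exact hpp.ne_top ((Ideal.eq_top_iff_one _).2 ((hz 1).2 (by rw [h0, smul_zero])))
    -- Let N be the submodule killed by p. If N ⊆ xM, then N = xN because x is regular, so N = 0 by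
    -- Nakayama; but z is a non-zero element of N.
    obtain ⟨w, hw, hwx⟩ : ∃ w : M, (∀ r ∈ p, r • w = 0) ∧ w ∉ x • (⊤ : Submodule R M) := by
      by_contra! hcon
      let N : Submodule R M := Submodule.torsionBySet R M p
      have hN : ∀ m, m ∈ N ↔ ∀ r ∈ p, r • m = 0 := fun m => by
        rw [Submodule.mem_torsionBySet_iff]; simp
      have h1 : N ≤ Ideal.span {x} • N := by
        intro m hm
        obtain ⟨m', -, rfl⟩ :=
          (Submodule.mem_smul_pointwise_iff_exists _ _ _).1 (hcon m ((hN m).1 hm))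
        rw [Submodule.ideal_span_singleton_smul]
        refine Submodule.smul_mem_pointwise_smul _ _ _ ((hN _).2 fun r hr => h.1 ?_)
        dsimp only
        rw [smul_zero, smul_comm, (hN _).1 hm r hr]
      have h2 := Submodule.eq_bot_of_le_smul_of_le_jacobson_bot _ N (IsNoetherian.noetherian N) h1
        ((Ideal.span_singleton_le_iff_mem _).2 (maximalIdeal_le_jacobson _ hx))
      have h3 : z ∈ N := (hN z).2 fun r hr => (hz r).1 hr
      rw [h2, Submodule.mem_bot] at h3
      exact hpp.ne_top ((Ideal.eq_top_iff_one _).2 ((hz 1).2 (by rw [h3, smul_zero])))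
    -- The class of w in M/xM is non-zero and killed by p and x, so some associated prime q of M/xM
    -- strictly contains p.
    obtain ⟨q, hq, hle⟩ := exists_le_isAssociatedPrime_of_isNoetherianRing R
      ((x • (⊤ : Submodule R M)).mkQ w)
      (by rwa [Submodule.mkQ_apply, Ne, Submodule.Quotient.mk_eq_zero])
    have hpq : p ≤ q := fun r hr => hle (by
      rw [Submodule.mem_colon_singleton, ← map_smul, hw r hr, map_zero]; exact zero_mem _)
    have hxq : x ∈ q := hle (by
      rw [Submodule.mem_colon_singleton, ← map_smul, Submodule.mem_bot, Submodule.mkQ_apply,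
        Submodule.Quotient.mk_eq_zero]
      exact Submodule.smul_mem_pointwise_smul _ _ _ trivial)
    refine le_trans ?_ (ringKrullDim_quotient_succ_le_of_lt hpq hxp hxq)
    rw [List.length_cons, Nat.cast_succ]
    gcongr
    exact length_le_ringKrullDim_quotient_of_mem_associatedPrimes rs (QuotSMulTop x M) q
      (fun r hr => hrs r (by simp [hr])) h.2 hq

end Depth

/-! ### Vanishing of the delta invariant and the depth of the Koszul homology of I. -/

section Delta

open RingTheory.Sequence IsLocalRing

theorem ringKrullDim_quotient_le_supportDim {R : Type u} [CommRing R] {M : Type v} [AddCommGroup M]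
    [Module R M] {p : PrimeSpectrum R} (hp : p ∈ Module.support R M) :
    ringKrullDim (R ⧸ p.asIdeal) ≤ Module.supportDim R M := by
  rw [ringKrullDim_quotient]
  exact Order.krullDim_le_of_strictMono
    (fun q => ⟨q.1, Module.mem_support_mono (show p ≤ q.1 from q.2) hp⟩) fun _ _ h => h

theorem deltaInvariant_eq_zero_of_cmPart_eq_top {A : Type u} [CommRing A] {M : Type v}
    [AddCommGroup M] [Module A M] (h : cmPart A M = ⊤) : deltaInvariant A M = 0 := by
  have : Subsingleton (M ⧸ cmPart A M) := Submodule.Quotient.subsingleton_iff.2 h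
  rw [deltaInvariant, Subsingleton.elim (⊤ : Submodule A (M ⧸ cmPart A M)) ⊥,
    Submodule.spanFinrank_bot]

theorem deltaInvariant_eq_zero_of_subsingleton {A : Type u} [CommRing A] {M : Type v}
    [AddCommGroup M] [Module A M] [Subsingleton M] : deltaInvariant A M = 0 :=
  deltaInvariant_eq_zero_of_cmPart_eq_top (Subsingleton.elim _ _)

/-- A maximal Cohen–Macaulay module without free summands has vanishing delta invariant. -/
theorem deltaInvariant_eq_zero_of_isMaximalCohenMacaulayModule {A : Type u} [CommRing A]
    {M : Type u} [AddCommGroup M] [Module A M] (h : IsMaximalCohenMacaulayModule A M)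
    (h' : HasNoFreeSummand A M) : deltaInvariant A M = 0 :=
  deltaInvariant_eq_zero_of_cmPart_eq_top <| top_unique <| le_sSup
    ⟨M, inferInstance, inferInstance, h, h', LinearMap.id, LinearMap.range_id⟩

/-- A non-zero free module is faithful. -/
theorem hasNoFreeSummand_of_smul_eq_zero {A : Type u} [CommRing A] {M : Type v} [AddCommGroup M]
    [Module A M] {a : A} (ha : a ≠ 0) (h : ∀ m : M, a • m = 0) : HasNoFreeSummand A M := by
  intro N P _ hN
  by_contra hne
  have : Nontrivial N := Submodule.nontrivial_iff_ne_bot.2 hne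
  have : FaithfulSMul A N := inferInstance
  exact ha (FaithfulSMul.eq_of_smul_eq_smul (α := N) fun m => by
    rw [zero_smul]; exact Subtype.ext (h m))

/-- A module over a quotient ring of dimension `D` admitting a weakly regular sequence of length `D`
is maximal Cohen–Macaulay. -/
theorem isMaximalCohenMacaulayModule_quotient {R : Type u} [CommRing R] [IsLocalRing R]
    [IsNoetherianRing R] {J : Ideal R} (hJ : J ≠ ⊤) {M : Type v} [AddCommGroup M] [Module R M]
    [Module.Finite R M] [Nontrivial M] [Module (R ⧸ J) M] [IsScalarTower R (R ⧸ J) M] {D : ℕ}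
    (hD : ringKrullDim (R ⧸ J) = D) {rs : List R} (hl : rs.length = D)
    (hrs : ∀ r ∈ rs, r ∈ maximalIdeal R) (h : IsWeaklyRegular M rs) :
    IsMaximalCohenMacaulayModule (R ⧸ J) M := by
  have : Nontrivial (R ⧸ J) := Ideal.Quotient.nontrivial_iff.2 hJ
  have : IsLocalRing (R ⧸ J) :=
    IsLocalRing.of_surjective' (Ideal.Quotient.mk J) Ideal.Quotient.mk_surjective
  have : IsLocalHom (Ideal.Quotient.mk J) := .of_surjective _ Ideal.Quotient.mk_surjective
  have hfin : Module.Finite (R ⧸ J) M := Module.Finite.of_restrictScalars_finite R (R ⧸ J) M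
  refine ⟨hfin, inferInstance, le_antisymm (moduleDepth_le_supportDim.trans
    (Module.supportDim_le_ringKrullDim _ _)) ?_⟩
  have h1 : ∀ r ∈ rs.map (algebraMap R (R ⧸ J)), r ∈ maximalIdeal (R ⧸ J) := by
    intro r hr
    obtain ⟨a, ha, rfl⟩ := List.mem_map.1 hr
    exact fun hu => hrs a ha (isUnit_of_map_unit (Ideal.Quotient.mk J) a hu)
  have h2 := le_moduleDepth (M := M) h1 ((isWeaklyRegular_map_algebraMap_iff (R ⧸ J) M rs).2 h)
  rw [List.length_map, hl] at h2
  rw [hD]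
  exact_mod_cast h2

theorem length_le_of_spanFinrank_eq {R : Type u} [CommRing R] {rs : List R} {n : ℕ} (h : n = (Ideal.ofList rs).spanFinrank) :
    n ≤ rs.length := by
  classical
  have h1 : Ideal.ofList rs = Submodule.span R (rs.toFinset : Set R) :=
    congrArg Ideal.span (by ext; simp)
  rw [h, h1]
  refine (Submodule.spanFinrank_span_le_ncard_of_finite (Finset.finite_toSet _)).trans ?_
  rw [Set.ncard_coe_finset]
  exact rs.toFinset_card_le

variable {R : Type u} [CommRing R] [IsLocalRing R] [IsNoetherianRing R]

/-- A maximal regular sequence in a proper ideal `I` of a Cohen–Macaulay local ring of dimension `d`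
has an associated prime `p` of the quotient containing `I` with `dim R ⧸ p` at least the dimension
of the quotient. -/
theorem IsMaximalRegularSequenceIn.exists_associatedPrime (hR : IsCohenMacaulayModule R R)
    {I : Ideal R} (hI : I ≠ ⊤) {rs : List R} (hrs : IsMaximalRegularSequenceIn I rs) {D : ℕ}
    (hD : ringKrullDim (R ⧸ Ideal.ofList rs) = D) :
    ∃ p ∈ associatedPrimes R (R ⧸ (Ideal.ofList rs • ⊤ : Submodule R R)), I ≤ p ∧
      (D : WithBot ℕ∞) ≤ ringKrullDim (R ⧸ p) := by
  have hIm : I ≤ maximalIdeal R := le_maximalIdeal hI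
  obtain ⟨p, hp, hIp⟩ : ∃ p ∈ associatedPrimes R (R ⧸ (Ideal.ofList rs • ⊤ : Submodule R R)),
      I ≤ p := by
    refine exists_associatedPrime_of_forall_not_isSMulRegular fun r hr hreg => hrs.2.2 r hr ?_
    refine (isRegular_iff_isWeaklyRegular_of_subset_maximalIdeal fun x hx => ?_).2
      ((isWeaklyRegular_append_iff R rs [r]).2
        ⟨hrs.2.1.toIsWeaklyRegular, (isWeaklyRegular_singleton_iff _ r).2 hreg⟩)
    rcases List.mem_append.1 hx with hx | hx
    · exact hIm (hrs.1 x hx)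
    · rw [List.mem_singleton.1 hx]; exact hIm hr
  refine ⟨p, hp, hIp, ?_⟩
  obtain ⟨k, y, hy⟩ := Submodule.fg_iff_exists_fin_generating_family.1
    (IsNoetherian.noetherian (maximalIdeal R))
  have hdim := ringKrullDim_add_length_eq_ringKrullDim_of_isRegular rs hrs.2.1
  rw [hD] at hdim
  have hdepth : ((D + rs.length : ℕ) : ℕ∞) ≤ moduleDepth R R := by
    have := hR.2 inferInstance
    rw [Module.supportDim_self_eq_ringKrullDim, ← hdim] at this
    have h2 : moduleDepth R R = ((D + rs.length : ℕ) : ℕ∞) := by exact_mod_cast this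
    exact h2.ge
  have := hrs.2.1.quot_ofList_smul_nontrivial (⊤ : Submodule R R)
  -- R has depth D + g, so K(y; R) is acyclic in the top D + g degrees and K(y; R/J) in the top D:
  -- R/J has depth at least D.
  obtain ⟨ss, h1, h2, h3⟩ := exists_isWeaklyRegular_of_koszulKilled hy D
    (R ⧸ (Ideal.ofList rs • ⊤ : Submodule R R)) fun j hj =>
      koszulKilled_quotient_of_isWeaklyRegular hrs.2.1.toIsWeaklyRegular
        (fun i hi => koszulKilled_of_le_moduleDepth hy hdepth hi) hj
  rw [← h1]
  exact length_le_ringKrullDim_quotient_of_mem_associatedPrimes ss _ p h2 h3 hp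

/-- If `I` is strongly Cohen–Macaulay with respect to `g`, then every Koszul homology module of `R`
with respect to any generators of `I` is zero or has depth at least the dimension of the quotient by
a maximal regular sequence in `I`. -/
theorem IsMaximalRegularSequenceIn.koszulKilled_koszulHomology (hR : IsCohenMacaulayModule R R)
    {I : Ideal R} (hI : I ≠ ⊤) {rs : List R} (hrs : IsMaximalRegularSequenceIn I rs) {D : ℕ}
    (hD : ringKrullDim (R ⧸ Ideal.ofList rs) = D) {k : ℕ} {y : Fin k → R}
    (hy : Ideal.span (Set.range y) = maximalIdeal R) {m : ℕ} {g : Fin m → R}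
    (hg : Ideal.span (Set.range g) = I) (hgI : ∀ i, IsCohenMacaulayModule R (koszulHomology R g i))
    {n : ℕ} {f : Fin n → R} (hf : Ideal.span (Set.range f) = I) (i : ℕ) {j : ℕ} (hj : k < j + D) :
    KoszulKilled (koszulHomology R f i) y 1 j := by
  obtain ⟨p, hp, hIp, hdim⟩ := hrs.exists_associatedPrime hR hI hD
  let P : PrimeSpectrum R := ⟨p, hp.1⟩
  -- `i₀` is m minus the length of `rs`, the last degree in which homology can be non-zero.
  obtain ⟨i₀, hi₀, hk₀⟩ := exists_forall_not_koszulKilled (f := g) (hg.trans_le hIp)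
    hrs.2.1.toIsWeaklyRegular (hg ▸ hrs.1) hp
  have hrigid : ∀ l i, (∃ s ∉ p, KoszulKilled R g s i) → ∃ s ∉ p, KoszulKilled R g s (i + l) := by
    intro l i h
    induction l with
    | zero => exact h
    | succ l ih =>
      exact exists_koszulKilled_succ P g (fun j => hIp (hg ▸ Ideal.subset_span ⟨j, rfl⟩)) _ ih
  have key : ∀ i j, k < j + D → KoszulKilled (koszulHomology R g i) y 1 j := by
    intro i j hj
    rcases subsingleton_or_nontrivial (koszulHomology R g i) with hs | hn
    · intro z _
      rw [Subsingleton.elim z 0, smul_zero]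
      exact zero_mem _
    · refine koszulKilled_of_le_moduleDepth hy ?_ hj
      -- Below `i₀`, vanishing at p would propagate up to `i₀` by rigidity; above `i₀` the homology
      -- is zero.
      have hsupp : P ∈ Module.support R (koszulHomology R g i) := by
        refine (mem_support_koszulHomology_iff g i P).2 fun s hs hs' => ?_
        rcases le_or_gt i i₀ with hle | hlt
        · obtain ⟨t, ht, ht'⟩ := hrigid (i₀ - i) i ⟨s, hs, hs'⟩
          rw [Nat.add_sub_cancel' hle] at ht'
          exact hk₀ t ht ht'
        · have h1 : KoszulKilled R g 1 i := koszulKilled_of_isWeaklyRegular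
            hrs.2.1.toIsWeaklyRegular (hg ▸ hrs.1) (by omega)
          rw [koszulKilled_one_iff] at h1
          exact not_subsingleton _ h1
      have h2 : ringKrullDim (R ⧸ p) ≤ Module.supportDim R (koszulHomology R g i) :=
        ringKrullDim_quotient_le_supportDim (p := P) hsupp
      have h3 : (D : WithBot ℕ∞) ≤ moduleDepth R (koszulHomology R g i) :=
        (hdim.trans h2).trans_eq ((hgI i).2 hn).symm
      exact_mod_cast h3
  -- In its Koszul form the depth bound also holds for zero modules and is compatible with products,
  -- so it transfers from `g` to `f`.
  have h3 := forall_koszulHomology_iff_of_span_eq (M := R)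
    (fun N _ _ => ∀ j, k < j + D → KoszulKilled N y 1 j)
    (fun N N' _ _ _ _ e h j hj => (h j hj).of_equiv e)
    (fun N N' _ _ _ _ => by simp only [koszulKilled_prod_iff, forall_and]) g f (hg.trans hf.symm)
  exact h3.1 key i j hj

end Delta

theorem proposition3p1 {R : Type u} [CommRing R] [IsLocalRing R] [IsNoetherianRing R]
    (hR : IsCohenMacaulayModule R R)
    (ω : Type u) [AddCommGroup ω] [Module R ω] (hω : IsCanonicalModule R ω)
    (I : Ideal R) (hI : IsStronglyCohenMacaulay I)
    (rs : List R) (hrs : IsMaximalRegularSequenceIn I rs)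
    (n : ℕ) (f : Fin n → R) (hf : Ideal.span (Set.range f) = I)
    (hmin : n = I.spanFinrank ∨ Ideal.ofList rs ≠ I)
    (i : ℕ) (hi : 0 < i) :
    letI : Module (R ⧸ Ideal.ofList rs) (koszulHomology R f i) :=
      koszulHomologyQuotientModule R f i (Ideal.ofList rs) (hrs.ofList_le.trans hf.ge)
    deltaInvariant (R ⧸ Ideal.ofList rs) (koszulHomology R f i) = 0 := by
  let : Module (R ⧸ Ideal.ofList rs) (koszulHomology R f i) :=
    koszulHomologyQuotientModule R f i (Ideal.ofList rs) (hrs.ofList_le.trans hf.ge)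
  have htower : IsScalarTower R (R ⧸ Ideal.ofList rs) (koszulHomology R f i) :=
    (koszulHomology_isTorsionBySet R f i _ (hrs.ofList_le.trans hf.ge)).isScalarTower
  change deltaInvariant (R ⧸ Ideal.ofList rs) (koszulHomology R f i) = 0
  rcases subsingleton_or_nontrivial (koszulHomology R f i) with hs | hn
  · exact deltaInvariant_eq_zero_of_subsingleton
  have hann := koszulHomology_isTorsionBySet R f i I hf.ge
  -- If J = I, then n is at most the length of `rs`, and all homology in positive degrees vanishes.
  have hJI : Ideal.ofList rs ≠ I := by
    intro hJI
    have hlen : n ≤ rs.length :=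
      length_le_of_spanFinrank_eq (hJI ▸ hmin.resolve_right fun h => h hJI)
    have h1 : KoszulKilled R f 1 i := koszulKilled_of_isWeaklyRegular
      hrs.2.1.toIsWeaklyRegular (hf ▸ hrs.1) (by omega)
    rw [koszulKilled_one_iff] at h1
    exact not_subsingleton _ h1
  have hItop : I ≠ ⊤ := by
    intro h
    obtain ⟨x, hx⟩ := exists_ne (0 : koszulHomology R f i)
    have h1 : (1 : R) • x = 0 := @hann x ⟨1, h ▸ Submodule.mem_top⟩
    exact hx (by rwa [one_smul] at h1)
  have hJtop : Ideal.ofList rs ≠ ⊤ := fun h => hItop (top_unique (h ▸ hrs.ofList_le))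
  have : Nontrivial (R ⧸ Ideal.ofList rs) := Ideal.Quotient.nontrivial_iff.2 hJtop
  obtain ⟨D, hD⟩ : ∃ D : ℕ, ringKrullDim (R ⧸ Ideal.ofList rs) = D := by
    have : IsLocalRing (R ⧸ Ideal.ofList rs) :=
      IsLocalRing.of_surjective' (Ideal.Quotient.mk _) Ideal.Quotient.mk_surjective
    have h1 : ringKrullDim (R ⧸ Ideal.ofList rs) ≠ ⊤ := ringKrullDim_lt_top.ne
    have h2 : ringKrullDim (R ⧸ Ideal.ofList rs) ≠ ⊥ := ringKrullDim_ne_bot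
    obtain ⟨e, he⟩ := WithBot.ne_bot_iff_exists.1 h2
    rw [← he] at h1
    obtain ⟨D, rfl⟩ := ENat.ne_top_iff_exists.1 (fun h : e = ⊤ => h1 (by rw [h]; rfl))
    exact ⟨D, he.symm⟩
  obtain ⟨k, y, hy⟩ := Submodule.fg_iff_exists_fin_generating_family.1
    (IsNoetherian.noetherian (IsLocalRing.maximalIdeal R))
  obtain ⟨m, g, hg, hgI⟩ := hI
  obtain ⟨ss, h1, h2, h3⟩ := exists_isWeaklyRegular_of_koszulKilled hy D (koszulHomology R f i)
    fun j hj => hrs.koszulKilled_koszulHomology hR hItop hD hy hg hgI hf i hj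
  -- The class of `a` is a non-zero element of R/J annihilating the homology, which rules out free
  -- summands.
  obtain ⟨a, haI, haJ⟩ := SetLike.exists_of_lt (lt_of_le_of_ne hrs.ofList_le hJI)
  refine deltaInvariant_eq_zero_of_isMaximalCohenMacaulayModule
    (isMaximalCohenMacaulayModule_quotient hJtop hD h1 h2 h3)
    (hasNoFreeSummand_of_smul_eq_zero (a := Ideal.Quotient.mk _ a)
      (fun h => haJ (Ideal.Quotient.eq_zero_iff_mem.1 h)) fun x => ?_)
  exact @hann x ⟨a, haI⟩
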